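/- **Theorem 3.18 (analogue of the toric Chow lemma).** Let $X$ be a Euclidean polyhedral space, $U\subset X$ an open subset, and $\Pi$ a polyhedral complex on $X$ such that only finitely many polyhedra of $\Pi$ meet $U$. Then there is a strongly concave piecewise affine function $f\colon X\to\mathbb{R}$ such that $S(\Pi,f)$ is a polyhedral complex on $X$ subdividing $\Pi$, only finitely many polyhedra of $S(\Pi,f)$ meet $U$, and $f|_U$ is strictly concave on $S(\Pi,f)|_U$. In particular, $S(\Pi,f)$ is a subdivision of $\Pi$ that is regular on $U$. The terms are as follows. *Polyhedral structures and spaces.* A *polyhedral structure* $\Pi$ on a second countable topological space $X$ is a locally finite covering of $X$ by closed subsets $\sigma$ (its polyhedra), each with a finite dimensional vector space $M_\sigma$ of continuous functions on $\sigma$ whose evaluation map $\sigma\to N_\sigma=\operatorname{Hom}(M_\sigma,\mathbb{R})$ is a homeomorphism onto a full-dimensional convex polyhedron of an affine hyperplane $H_\sigma$ of $N_\sigma$ not through $0$ (for $\sigma=\emptyset$, $M_\sigma=0$ and $H_\sigma=\emptyset$). It is required that every face of a polyhedron (including $\emptyset$) is a polyhedron of $\Pi$ with the restricted space of functions, and that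 any two polyhedra meet in a common face. We write $\tau\prec\sigma$ when $\tau$ is a face of $\sigma$, and $\dim\sigma=\dim M_\sigma-1$. A structure $\Pi'$ is a *subdivision* of $\Pi$ if each polyhedron of $\Pi'$ is contained in one of $\Pi$, with affine inclusion; two structures are equivalent if they have a common subdivision. A *polyhedral space* is a second countable space with an equivalence class of polyhedral structures. It is *Euclidean* if it is equipped with a map $\iota\colon X\to N$ into a finite dimensional Euclidean vector space, with image in a fixed affine hyperplane $H\not\ni 0$, such that $\iota$ is affine and injective on each polyhedron of some structure in the class; the structures in the class with this property are the *polyhedral complexes* on $X$. *Functions.* Write $\Pi|_U=\{\sigma\in\Pi: \sigma\cap U\neq\emptyset\}$, and $\Pi|_U(k)$ for its members of dimension $k$. A function $f\colon U\to\mathbb{R}$ is *defined on* $\Pi$ if on $\sigma\cap U$ it is given by an element of $M_\sigma$, for every $\sigma\in\Pi|_U$; it is *piecewise affine* if it is defined on some polyhedral complex on $X$. It is *strongly concave* if $f=f'\circ\iota$ on $U$ for a function $f'\colon H\to\mathbb{R}\cup\{\pm\infty\}$ with convex hypograph. For $f\colon X\to\mathbb{R}$ concave on each polyhedron of $\Pi$,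 $S(\Pi,f)$ is the set of all $\tau$ for which there are $\sigma\in\Pi$ with $\tau\subset\sigma$ and an affine function $\ell$ on $\sigma$ with $f=\ell$ on $\tau$ and $f<\ell$ on $\sigma\setminus\tau$. *Strict concavity.* For a nonempty facet $\tau$ of $\sigma$ let $v_{\sigma\setminus\tau}\in N$ be the unit vector parallel to the affine span of $\iota(\sigma)$, orthogonal to that of $\iota(\tau)$ and pointing from $\tau$ towards $\sigma$. For $V$ open, a *positive Minkowski weight* $c\in M^+_{k+1}(\Pi|_V)$ is a function $c\colon\Pi|_V(k+1)\to\mathbb{R}_{\ge0}$ with $\sum_{\sigma\in\Pi|_V(k+1),\,\sigma\succ\tau}c(\sigma)\,v_{\sigma\setminus\tau}=0$ for all $\tau\in\Pi|_V(k)$. For a function $f$ on $V$ defined on $\Pi$, put $(f\cdot c)(\tau)=-\sum_{\sigma\in\Pi|_V(k+1),\,\sigma\succ\tau}c(\sigma)\,f_\sigma(v_{\sigma\setminus\tau})$, where $f_\sigma$ is a linear function on $N$ with $f=f_\sigma\circ\iota$ on $\sigma\cap V$. A piecewise affine function $f$ on $U$ is *strictly concave on* $\Pi|_U$ if it is defined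 on $\Pi$ and, for every $k\ge 0$, every $\tau\in\Pi|_U(k)$, every open $V\subset U$ with $V\cap\tau\ne\emptyset$, and every $c\in M^+_{k+1}(\Pi|_V)$ with $c(\sigma)>0$ for some $\sigma\in\Pi|_V(k+1)$ with $\sigma\succ\tau$, one has $(f|_V\cdot c)(\tau)>0$. The complex $\Pi$ is *regular on* $U$ if there is a piecewise affine function on $U$ that is strictly concave on $\Pi|_U$. -/

import Mathlib

open Set

noncomputable section

namespace PolyhedralSpaces

/-! ### Convex polyhedra in real vector spaces -/

/-- A convex polyhedron: the solution set of finitely many (weak) affine inequalities.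
The empty set and the whole space are allowed. -/
def IsPolyhedron {W : Type*} [AddCommGroup W] [Module ℝ W] (C : Set W) : Prop :=
  ∃ s : Finset (W →ᵃ[ℝ] ℝ), C = {x | ∀ a ∈ s, 0 ≤ a x}

/-- Faces of a convex set in the sense of convex analysis: a convex subset `F` of `C` such that
every segment of `C` having a relative interior point in `F` has its end points in `F`. The empty
set and `C` itself are faces of `C`. -/
def IsFaceOf {W : Type*} [AddCommGroup W] [Module ℝ W] (C F : Set W) : Prop :=
  Convex ℝ F ∧ IsExtreme ℝ C F

/-- The evaluation map `φ : S → N = Hom(M, ℝ)` of a vector space `M` of functions on `S`. -/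
def ev {S : Type*} (M : Submodule ℝ (S → ℝ)) (x : S) : Module.Dual ℝ M :=
  (LinearMap.proj x).comp M.subtype

/-- `M` is a finite dimensional space of continuous functions on `S` whose evaluation map sends `S`
homeomorphically onto a full-dimensional convex polyhedron of an affine hyperplane of
`N = Hom(M, ℝ)` that does not pass through the origin.

* The canonical topology of the finite dimensional space `N` is that of pointwise convergence on
  `M`, hence the form of `isEmbedding`.
* A hyperplane of `N` not passing through the origin is `{φ | φ u = 1}` for some `u ∈ M`.
  If `S` is empty then `M = 0`, `N = 0` and this set is empty. -/
structure IsPolyhedralChart {S : Type*} [TopologicalSpace S] (M : Submodule ℝ (S → ℝ)) :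
    Prop where
  finiteDimensional : FiniteDimensional ℝ M
  continuous : ∀ m ∈ M, Continuous m
  isEmbedding : Topology.IsEmbedding (fun (x : S) (m : M) => ev M x m)
  isPolyhedron : IsPolyhedron (range (ev M))
  fullDimensional : ∃ u : M,
    (affineSpan ℝ (range (ev M)) : Set (Module.Dual ℝ M)) = {φ | φ u = 1}

/-! ### Polyhedral structures -/

/-- The faces of a subset `σ` of `X`, with respect to a space `M` of functions on it: the preimages
under the evaluation map of the faces of the image of `σ`. -/
def IsCellFace {X : Type*} (σ : Set X) (M : Submodule ℝ (σ → ℝ)) (τ : Set X) : Prop :=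
  ∃ F : Set (Module.Dual ℝ M), IsFaceOf (range (ev M)) F ∧ τ = Subtype.val '' (ev M ⁻¹' F)

/-- A polyhedral structure on a topological space `X`. The collection of polyhedra is `cells`, and
the polyhedron `σ` is equipped with the space of functions `M σ`. Only the values of `M` at members
of `cells` matter. -/
structure PolyhedralStructure (X : Type*) [TopologicalSpace X] where
  cells : Set (Set X)
  M : ∀ σ : Set X, Submodule ℝ (σ → ℝ)
  isClosed : ∀ σ ∈ cells, IsClosed σ
  covers : ⋃₀ cells = univ
  locallyFinite : LocallyFinite (fun σ : cells => (σ : Set X))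
  chart : ∀ σ ∈ cells, IsPolyhedralChart (M σ)
  face_mem : ∀ σ ∈ cells, ∀ τ, IsCellFace σ (M σ) τ → τ ∈ cells
  face_M : ∀ σ ∈ cells, ∀ τ, IsCellFace σ (M σ) τ → ∀ g : τ → ℝ,
    g ∈ M τ ↔ ∃ m ∈ M σ, ∀ (x : X) (hτ : x ∈ τ) (hσ : x ∈ σ), g ⟨x, hτ⟩ = m ⟨x, hσ⟩
  inter_face : ∀ σ ∈ cells, ∀ σ' ∈ cells,
    IsCellFace σ (M σ) (σ ∩ σ') ∧ IsCellFace σ' (M σ') (σ ∩ σ')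

namespace PolyhedralStructure

/-- A map from the polyhedron `σ` to a vector space is affine, for the affine structure that `σ`
inherits from the dual of `M σ`. -/
def IsAffineOn {X : Type*} [TopologicalSpace X] (P : PolyhedralStructure X) (σ : Set X)
    {W : Type*} [AddCommGroup W] [Module ℝ W] (g : σ → W) : Prop :=
  ∃ L : Module.Dual ℝ (P.M σ) →ᵃ[ℝ] W, ∀ x : σ, g x = L (ev (P.M σ) x)

/-- `P'` is a subdivision of `P`: every polyhedron of `P'` is contained in a polyhedron of `P`, the
inclusion being an affine map. -/
def IsSubdivision {X : Type*} [TopologicalSpace X] (P' P : PolyhedralStructure X) : Prop :=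
  ∀ σ' ∈ P'.cells, ∃ σ ∈ P.cells, ∃ h : σ' ⊆ σ,
    P'.IsAffineOn σ' (fun x : σ' => ev (P.M σ) (inclusion h x))

/-- Two polyhedral structures are equivalent if they admit a common subdivision. -/
def Equivalent {X : Type*} [TopologicalSpace X] (P P' : PolyhedralStructure X) : Prop :=
  ∃ Q : PolyhedralStructure X, Q.IsSubdivision P ∧ Q.IsSubdivision P'

/-- `τ ≺ σ`: `τ` is a face of the polyhedron `σ`. -/
def Face {X : Type*} [TopologicalSpace X] (P : PolyhedralStructure X) (τ σ : Set X) : Prop :=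
  IsCellFace σ (P.M σ) τ

/-- The restriction of `P` to `U`: the polyhedra of `P` that meet `U`. -/
def restrict {X : Type*} [TopologicalSpace X] (P : PolyhedralStructure X) (U : Set X) :
    Set (Set X) :=
  {σ ∈ P.cells | (σ ∩ U).Nonempty}

/-- The polyhedra of dimension `k` that meet `U`. The dimension of `σ` is `dim (M σ) - 1`. -/
def restrictDim {X : Type*} [TopologicalSpace X] (P : PolyhedralStructure X) (U : Set X) (k : ℕ) :
    Set (Set X) :=
  {σ ∈ P.restrict U | Module.finrank ℝ (P.M σ) = k + 1}

/-- The polyhedra of dimension `k` that meet `U` and have `τ` as a face. -/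
def cofaces {X : Type*} [TopologicalSpace X] (P : PolyhedralStructure X) (U : Set X) (k : ℕ)
    (τ : Set X) : Set (Set X) :=
  {σ ∈ P.restrictDim U k | P.Face τ σ}

/-- A function is defined on `P`, over the open set `U`: on each `σ ∩ U`, with `σ` a polyhedron
meeting `U`, it is given by an element of `M σ`. -/
def DefinedOn {X : Type*} [TopologicalSpace X] (P : PolyhedralStructure X) (U : Set X)
    (f : X → ℝ) : Prop :=
  ∀ σ ∈ P.restrict U, ∃ m ∈ P.M σ, ∀ x : σ, (x : X) ∈ U → f x = m x

/-- The set of polyhedra `S(P, f) = ⋃_{σ ∈ P} Π(f|_σ)`, where the polyhedral complex `Π(f|_σ)` of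
the affinity loci of a concave function on `σ` consists of the sets `τ ⊆ σ` for which there is an
affine function `l` on `σ` with `f = l` on `τ` and `f < l` on `σ \ τ`. -/
def affinityLoci {X : Type*} [TopologicalSpace X] (P : PolyhedralStructure X) (f : X → ℝ) :
    Set (Set X) :=
  {τ | ∃ σ ∈ P.cells, τ ⊆ σ ∧ ∃ l ∈ P.M σ,
    ∀ x : σ, ((x : X) ∈ τ → f x = l x) ∧ ((x : X) ∉ τ → f x < l x)}

end PolyhedralStructure

/-! ### Quasi-embedded and Euclidean polyhedral spaces -/

/-- A polyhedral space: a topological space with an equivalence class of polyhedral structures. -/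
structure PolyhedralSpace (X : Type*) [TopologicalSpace X] where
  structures : Set (PolyhedralStructure X)
  isClass : ∃ P₀ : PolyhedralStructure X, structures = {P | P₀.Equivalent P}

/-- The restriction of `ι` to every polyhedron of `P` is affine and injective. -/
def PolyhedralStructure.Adapted {X : Type*} [TopologicalSpace X] (P : PolyhedralStructure X)
    {N : Type*} [AddCommGroup N] [Module ℝ N] (ι : X → N) : Prop :=
  ∀ σ ∈ P.cells, P.IsAffineOn σ (fun x : σ => ι x) ∧ InjOn ι σ

/-- A quasi-embedded polyhedral space `(X, N, ι)`. The image of `ι` lies in the affine hyperplane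
`H = {v | height v = 1}`, which does not contain zero; every affine hyperplane not containing zero
is of this form. When `N` is an inner product space, this is a Euclidean polyhedral space. -/
structure QuasiEmbeddedPolyhedralSpace (X : Type*) [TopologicalSpace X]
    (N : Type*) [AddCommGroup N] [Module ℝ N] extends PolyhedralSpace X where
  ι : X → N
  height : Module.Dual ℝ N
  height_ne_zero : height ≠ 0
  height_ι : ∀ x, height (ι x) = 1
  exists_adapted : ∃ P ∈ structures, P.Adapted ι

namespace QuasiEmbeddedPolyhedralSpace

/-- `P` is a polyhedral complex on the quasi-embedded polyhedral space. -/
def IsComplex {X : Type*} [TopologicalSpace X] {N : Type*} [AddCommGroup N] [Module ℝ N]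
    (E : QuasiEmbeddedPolyhedralSpace X N) (P : PolyhedralStructure X) : Prop :=
  P ∈ E.structures ∧ P.Adapted E.ι

/-- The restriction of `f` to the open set `U` is a piecewise affine function on `U`. -/
def IsPiecewiseAffine {X : Type*} [TopologicalSpace X] {N : Type*} [AddCommGroup N] [Module ℝ N]
    (E : QuasiEmbeddedPolyhedralSpace X N) (U : Set X) (f : X → ℝ) : Prop :=
  ∃ P : PolyhedralStructure X, E.IsComplex P ∧ P.DefinedOn U f

/-- The restriction of `f` to `U` is the pullback by `ι` of a concave function `f'` on the
hyperplane `H`, possibly with infinite values; concave means that the hypograph is convex. -/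
def IsStronglyConcave {X : Type*} [TopologicalSpace X] {N : Type*} [AddCommGroup N] [Module ℝ N]
    (E : QuasiEmbeddedPolyhedralSpace X N) (U : Set X) (f : X → ℝ) : Prop :=
  ∃ f' : N → EReal,
    Convex ℝ {p : N × ℝ | E.height p.1 = 1 ∧ (p.2 : EReal) ≤ f' p.1} ∧
    ∀ x ∈ U, (f x : EReal) = f' (E.ι x)

/-- `v` is the unit vector normal to `τ` in the direction of `σ`: it is a unit vector parallel to
the affine span of `ι(σ)`, orthogonal to that of `ι(τ)`, and it points from `τ` towards `σ`. -/
def IsUnitNormal {X : Type*} [TopologicalSpace X] {N : Type*} [NormedAddCommGroup N]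
    [InnerProductSpace ℝ N] (E : QuasiEmbeddedPolyhedralSpace X N) (τ σ : Set X) (v : N) : Prop :=
  ‖v‖ = 1 ∧ v ∈ vectorSpan ℝ (E.ι '' σ) ∧ (∀ w ∈ vectorSpan ℝ (E.ι '' τ), inner ℝ w v = 0) ∧
    ∀ x ∈ τ, ∀ y ∈ σ, 0 ≤ inner ℝ (E.ι y - E.ι x) v

open Classical in
/-- The vector `v_{σ∖τ}`, for `τ` a nonempty facet of `σ` (and an irrelevant value otherwise). -/
def unitNormal {X : Type*} [TopologicalSpace X] {N : Type*} [NormedAddCommGroup N]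
    [InnerProductSpace ℝ N] (E : QuasiEmbeddedPolyhedralSpace X N) (τ σ : Set X) : N :=
  if h : ∃ v, E.IsUnitNormal τ σ v then h.choose else 0

open Classical in
/-- A linear function `f_σ` on `N` with `f = f_σ ∘ ι` on `σ ∩ U`. Its restriction to the linear span
of `ι(σ)` does not depend on the choice when `σ` is a polyhedron that meets the open set `U` and `f`
is affine on `σ ∩ U`. -/
def linearPart {X : Type*} [TopologicalSpace X] {N : Type*} [AddCommGroup N] [Module ℝ N]
    (E : QuasiEmbeddedPolyhedralSpace X N) (U : Set X) (f : X → ℝ) (σ : Set X) :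
    Module.Dual ℝ N :=
  if h : ∃ g : Module.Dual ℝ N, ∀ x ∈ σ ∩ U, f x = g (E.ι x) then h.choose else 0

/-- `c` is a positive Minkowski weight of dimension `k + 1` on `P|_U`. Only the values of `c` at the
polyhedra of dimension `k + 1` that meet `U` matter. The sum is finite, since the nonempty set `τ`
is contained in only finitely many polyhedra. -/
def IsPositiveMinkowskiWeight {X : Type*} [TopologicalSpace X] {N : Type*} [NormedAddCommGroup N]
    [InnerProductSpace ℝ N] (E : QuasiEmbeddedPolyhedralSpace X N) (P : PolyhedralStructure X)
    (U : Set X) (k : ℕ) (c : Set X → ℝ) : Prop :=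
  (∀ σ ∈ P.restrictDim U (k + 1), 0 ≤ c σ) ∧
  ∀ τ ∈ P.restrictDim U k, ∑ᶠ σ ∈ P.cofaces U (k + 1) τ, c σ • E.unitNormal τ σ = 0

/-- The value at `τ ∈ P|_U(k)` of the product `f · c` of the piecewise affine function `f` on `U`
with the weight `c` of dimension `k + 1` on `P|_U`. -/
def product {X : Type*} [TopologicalSpace X] {N : Type*} [NormedAddCommGroup N]
    [InnerProductSpace ℝ N] (E : QuasiEmbeddedPolyhedralSpace X N) (P : PolyhedralStructure X)
    (U : Set X) (k : ℕ) (f : X → ℝ) (c : Set X → ℝ) (τ : Set X) : ℝ :=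
  - ∑ᶠ σ ∈ P.cofaces U (k + 1) τ, c σ * E.linearPart U f σ (E.unitNormal τ σ)

/-- The restriction of `f` to the open set `U` is strictly concave on `P|_U`. -/
def IsStrictlyConcave {X : Type*} [TopologicalSpace X] {N : Type*} [NormedAddCommGroup N]
    [InnerProductSpace ℝ N] (E : QuasiEmbeddedPolyhedralSpace X N) (P : PolyhedralStructure X)
    (U : Set X) (f : X → ℝ) : Prop :=
  P.DefinedOn U f ∧
  ∀ k : ℕ, ∀ τ ∈ P.restrictDim U k, ∀ V : Set X, IsOpen V → V ⊆ U → (V ∩ τ).Nonempty →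
    ∀ c : Set X → ℝ, E.IsPositiveMinkowskiWeight P V k c →
      (∃ σ ∈ P.cofaces V (k + 1) τ, 0 < c σ) → 0 < E.product P V k f c τ

/-- The polyhedral complex `P` is regular on `U`. -/
def IsRegular {X : Type*} [TopologicalSpace X] {N : Type*} [NormedAddCommGroup N]
    [InnerProductSpace ℝ N] (E : QuasiEmbeddedPolyhedralSpace X N) (P : PolyhedralStructure X)
    (U : Set X) : Prop :=
  ∃ f : X → ℝ, E.IsPiecewiseAffine U f ∧ E.IsStrictlyConcave P U f

end QuasiEmbeddedPolyhedralSpace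

end PolyhedralSpaces

end

open Set

noncomputable section

namespace PolyhedralSpaces

open Module Topology

/-! ### Polyhedra, their faces, and the directions they span. -/

section Polyhedra

variable {W : Type*} [AddCommGroup W] [Module ℝ W]

/-! Let `A` be a finite set of linear functions on `N` which, inside the height hyperplane, cut out
the images of the finitely many polyhedra of `P` that meet `U`. The required function is `bend A ∘
ι`, where `bend A` is minus the sum of the absolute values of the functions in `A`. It is a minimum
of finitely many linear functions (`le_bend_iff`), hence strongly concave.

Since `ι` is affine and injective on cells and lands at height one, the functions on a cell are
exactly the pullbacks of linear functions on `N` (`Adapted.M_eq`), so everything can be checked on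
images in `N`. There the affinity loci are polyhedra; their faces are again loci, as one sees in the
hypograph (`IsLocus.of_isFaceOf`); each is a face of one of finitely many chambers
(`IsLocus.exists_chamber`); and any two meet in a common face (`Adapted.isFaceOf_inter`). Bending a
common subdivision along the same `A` shows that the equivalence class is unchanged
(`Adapted.bending_equivalent`).

For strict concavity at `τ`, near `τ` the function is a linear `m` minus the sum of `|a|` over those
`a ∈ A` that vanish on `τ` (`exists_sub_eq_sum_abs`). Balancing kills `m`, so the product at `τ` is
a sum, over cofaces `σ`, of `c σ` times the values `|a v|` at the normal `v` of `σ`; it is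
nonnegative. If the term of a coface of positive weight vanished, all these `a` would kill `v`. From
a generic point of `τ` one could then move slightly along `-v` without leaving the coface, because
it is cut out by inequalities and sign conditions from `A`. This contradicts that `v` points inwards
(`IsInnerNormal.exists_ne_zero`). -/

theorem IsPolyhedron.convex {C : Set W} (hC : IsPolyhedron C) : Convex ℝ C := by
  obtain ⟨s, rfl⟩ := hC
  intro x hx y hy a b ha hb hab c hc
  rw [Convex.combo_affine_apply hab]
  exact add_nonneg (mul_nonneg ha (hx c hc)) (mul_nonneg hb (hy c hc))

theorem IsPolyhedron.inter {C D : Set W} (hC : IsPolyhedron C) (hD : IsPolyhedron D) :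
    IsPolyhedron (C ∩ D) := by
  classical
  obtain ⟨s, rfl⟩ := hC
  obtain ⟨t, rfl⟩ := hD
  refine ⟨s ∪ t, ?_⟩
  ext x
  simp only [mem_inter_iff, mem_ofPred_eq, Finset.mem_union]
  grind

theorem isPolyhedron_of_finset {I : Type*} (s : Finset I) (a : I → W →ᵃ[ℝ] ℝ) :
    IsPolyhedron {x | ∀ i ∈ s, 0 ≤ a i x} := by
  classical
  exact ⟨s.image a, by ext x; simp⟩

theorem IsPolyhedron.preimage {V : Type*} [AddCommGroup V] [Module ℝ V] {C : Set W}
    (hC : IsPolyhedron C) (g : V →ᵃ[ℝ] W) : IsPolyhedron (g ⁻¹' C) := by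
  obtain ⟨s, rfl⟩ := hC
  exact isPolyhedron_of_finset s fun a => a.comp g

theorem isPolyhedron_submodule [FiniteDimensional ℝ W] (K : Submodule ℝ W) :
    IsPolyhedron (K : Set W) := by
  classical
  obtain ⟨t, ht⟩ := IsNoetherian.noetherian K.dualAnnihilator
  have key : ∀ x, x ∈ K ↔ ∀ a ∈ t, a x = 0 := by
    intro x
    rw [← Subspace.dualAnnihilator_dualCoannihilator_eq (W := K), ← ht,
      Submodule.mem_dualCoannihilator]
    refine ⟨fun h a ha => h a (Submodule.subset_span ha), fun h a ha => ?_⟩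
    induction ha using Submodule.span_induction with
    | mem a ha => exact h a ha
    | zero => rfl
    | add a b _ _ ha hb => simp [ha, hb]
    | smul r a _ ha => simp [ha]
  have h1 := isPolyhedron_of_finset t fun a => (a : W →ₗ[ℝ] ℝ).toAffineMap
  have h2 := isPolyhedron_of_finset t fun a => (-a : W →ₗ[ℝ] ℝ).toAffineMap
  convert h1.inter h2 using 1
  ext x
  simp only [SetLike.mem_coe, key, mem_inter_iff, mem_ofPred_eq, LinearMap.coe_toAffineMap,
    LinearMap.neg_apply]
  constructor
  · intro h
    exact ⟨fun a ha => (h a ha).ge, fun a ha => by rw [h a ha, neg_zero]⟩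
  · rintro ⟨h, h'⟩ a ha
    linarith [h a ha, h' a ha]

theorem IsPolyhedron.image_of_injective {V : Type*} [AddCommGroup V] [Module ℝ V]
    [FiniteDimensional ℝ W] {C : Set V} (hC : IsPolyhedron C) {j : V →ₗ[ℝ] W}
    (hj : Function.Injective j) : IsPolyhedron (j '' C) := by
  obtain ⟨r, hr⟩ := j.exists_leftInverse_of_injective (LinearMap.ker_eq_bot.2 hj)
  have hr' : ∀ v, r (j v) = v := fun v => LinearMap.congr_fun hr v
  convert (isPolyhedron_submodule (LinearMap.range j)).inter (hC.preimage r.toAffineMap) using 1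
  ext x
  constructor
  · rintro ⟨v, hv, rfl⟩
    exact ⟨⟨v, rfl⟩, by simpa [hr'] using hv⟩
  · rintro ⟨⟨v, rfl⟩, hv⟩
    exact ⟨v, by simpa [hr'] using hv, rfl⟩

/-- In a convex set, finitely many affine functions can be tested at one point: those which are
nonnegative on the set and vanish at the point vanish identically. -/
theorem exists_generic_point {I : Type*} (s : Finset I) (a : I → W →ᵃ[ℝ] ℝ) {G : Set W}
    (hG : Convex ℝ G) (hne : G.Nonempty) :
    ∃ p ∈ G, ∀ i ∈ s, (∀ x ∈ G, 0 ≤ a i x) → a i p = 0 → ∀ x ∈ G, a i x = 0 := by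
  classical
  induction s using Finset.induction_on with
  | empty => exact ⟨hne.some, hne.some_mem, by simp⟩
  | insert i s _ ih =>
    obtain ⟨p, hp, h⟩ := ih
    by_cases hi : (∀ x ∈ G, 0 ≤ a i x) → a i p = 0 → ∀ x ∈ G, a i x = 0
    · refine ⟨p, hp, fun k hk => ?_⟩
      rcases Finset.mem_insert.1 hk with rfl | hk
      exacts [hi, h k hk]
    · push Not at hi
      -- Replace `p` by its midpoint with a point where `a i` is positive. A nonnegative function
      -- vanishing at the midpoint already vanished at `p`, so nothing gained before is lost.
      obtain ⟨h0, h1, x, hx, hxi⟩ := hi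
      have hmid : ∀ k, a k ((2⁻¹ : ℝ) • p + (2⁻¹ : ℝ) • x) = 2⁻¹ * a k p + 2⁻¹ * a k x :=
        fun k => Convex.combo_affine_apply (by norm_num)
      refine ⟨(2⁻¹ : ℝ) • p + (2⁻¹ : ℝ) • x,
        hG hp hx (by norm_num) (by norm_num) (by norm_num), fun k hk hk0 hkq => ?_⟩
      rw [hmid] at hkq
      rcases Finset.mem_insert.1 hk with rfl | hk
      · exact absurd (by linarith) hxi
      · exact h k hk hk0 (by linarith [hk0 p hp, hk0 x hx])

/-- Strict inequalities survive a short step, and tight ones survive any step that does not decrease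
them. -/
theorem exists_small_step {I : Type*} (s : Finset I) (α β : I → ℝ)
    (h : ∀ i ∈ s, 0 < α i ∨ (0 ≤ α i ∧ β i ≤ 0)) :
    ∃ δ : ℝ, 0 < δ ∧ ∀ i ∈ s, 0 ≤ α i - δ * β i := by
  have key : ∀ᶠ δ : ℝ in 𝓝[>] 0, ∀ i ∈ s, 0 ≤ α i - δ * β i := by
    refine (Filter.eventually_all_finset s).2 fun i hi => ?_
    rcases h i hi with h | ⟨h, h'⟩
    · have hc : Continuous fun δ : ℝ => α i - δ * β i := by fun_prop
      have := hc.continuousAt.eventually_mem (x := 0) (Ioi_mem_nhds (a := 0) (by simpa using h))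
      exact (this.filter_mono nhdsWithin_le_nhds).mono fun δ hδ => le_of_lt hδ
    · filter_upwards [self_mem_nhdsWithin] with δ hδ
      have := mul_nonneg (le_of_lt (mem_Ioi.1 hδ)) (neg_nonneg.2 h')
      linarith
  obtain ⟨δ, h1, h2⟩ := (key.and self_mem_nhdsWithin).exists
  exact ⟨δ, h2, h1⟩

/-- `J` consists of the inequalities tight at a generic point `p` of `G`. If they are also tight at
a point `x` of the polyhedron, the segment from `x` to `p` can be prolonged a little beyond `p`, and
extremality puts `x` in `G`. -/
theorem face_eq_of_inequalities (s : Finset (W →ᵃ[ℝ] ℝ)) {G : Set W}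
    (hG : IsFaceOf {x | ∀ a ∈ s, 0 ≤ a x} G) (hne : G.Nonempty) :
    ∃ J ⊆ s, G = {x | (∀ a ∈ s, 0 ≤ a x) ∧ ∀ a ∈ J, a x = 0} := by
  classical
  obtain ⟨p, hp, hgen⟩ := exists_generic_point s id hG.1 hne
  refine ⟨{a ∈ s | a p = 0}, Finset.filter_subset _ _, Subset.antisymm ?_ ?_⟩
  · intro x hx
    refine ⟨hG.2.subset hx, fun a ha => ?_⟩
    rw [Finset.mem_filter] at ha
    exact hgen a ha.1 (fun y hy => hG.2.subset hy a ha.1) ha.2 x hx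
  · rintro x ⟨hx, hxJ⟩
    have hps := hG.2.subset hp
    obtain ⟨δ, hδ, hstep⟩ := exists_small_step s (fun a => a p) (fun a => a x - a p) fun a ha => by
      rcases (hps a ha).lt_or_eq with h | h
      · exact Or.inl h
      · refine Or.inr ⟨h.le, ?_⟩
        rw [hxJ a (by simp [ha, ← h]), ← h, sub_zero]
    have hcomb : ∀ a : W →ᵃ[ℝ] ℝ, a ((1 + δ) • p + (-δ) • x) = (1 + δ) * a p + (-δ) * a x :=
      fun a => Convex.combo_affine_apply (by ring)
    -- The prolonged end point is `p + δ (p - x)`; the weights `δ / (1 + δ)` and `1 / (1 + δ)`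
    -- recover `p` from it and `x`.
    refine hG.2.left_mem_of_mem_openSegment hx (y := (1 + δ) • p + (-δ) • x) (fun a ha => ?_) hp
      ⟨δ / (1 + δ), 1 / (1 + δ), by positivity, by positivity, by field_simp; ring, ?_⟩
    · have := hstep a ha
      rw [hcomb]
      linarith
    · rw [smul_add, smul_smul, smul_smul]
      have : 1 + δ ≠ 0 := by positivity
      match_scalars <;> field_simp
      ring

theorem IsPolyhedron.finite_faces {C : Set W} (hC : IsPolyhedron C) :
    {G | IsFaceOf C G}.Finite := by
  obtain ⟨s, rfl⟩ := hC
  refine ((s.powerset.finite_toSet.image fun J =>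
    {x | (∀ a ∈ s, 0 ≤ a x) ∧ ∀ a ∈ J, a x = 0}).union (finite_singleton ∅)).subset ?_
  intro G hG
  rcases G.eq_empty_or_nonempty with h | h
  · exact Or.inr h
  · obtain ⟨J, hJ, h⟩ := face_eq_of_inequalities s hG h
    exact Or.inl ⟨J, by simpa using hJ, h.symm⟩

theorem affineMap_sum_apply (J : Finset (W →ᵃ[ℝ] ℝ)) (x : W) : (∑ a ∈ J, a) x = ∑ a ∈ J, a x := by
  classical
  induction J using Finset.induction_on with
  | empty => simp
  | insert a J ha ih =>
    rw [Finset.sum_insert ha, Finset.sum_insert ha, AffineMap.coe_add, Pi.add_apply, ih]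

/-- Add up the inequalities that define the face: a sum of nonnegative terms vanishes only where
each of them does. -/
theorem IsPolyhedron.exists_exposing {C G : Set W} (hC : IsPolyhedron C) (hG : IsFaceOf C G)
    (hne : G.Nonempty) :
    ∃ g : W →ᵃ[ℝ] ℝ, (∀ x ∈ C, 0 ≤ g x) ∧ G = {x ∈ C | g x = 0} := by
  classical
  obtain ⟨s, rfl⟩ := hC
  obtain ⟨J, hJ, rfl⟩ := face_eq_of_inequalities s hG hne
  have hsum := affineMap_sum_apply J
  refine ⟨∑ a ∈ J, a, fun x hx => ?_, ?_⟩
  · rw [hsum]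
    exact Finset.sum_nonneg fun a ha => hx a (hJ ha)
  · ext x
    simp only [mem_ofPred_eq, hsum]
    refine and_congr_right fun hx => ?_
    rw [Finset.sum_eq_zero_iff_of_nonneg fun a ha => hx a (hJ ha)]

theorem isExtreme_zeros {C : Set W} (g : W →ᵃ[ℝ] ℝ) (hg : ∀ x ∈ C, 0 ≤ g x) :
    IsExtreme ℝ C {x ∈ C | g x = 0} := by
  refine ⟨fun x hx => hx.1, ?_⟩
  rintro x hx y hy z ⟨_, hz⟩ ⟨a, b, ha, hb, hab, rfl⟩
  rw [Convex.combo_affine_apply hab] at hz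
  refine ⟨hx, ?_⟩
  have h1 := mul_nonneg hb.le (hg y hy)
  have h2 := mul_nonneg ha.le (hg x hx)
  simp only [smul_eq_mul] at hz
  have : a * g x = 0 := by linarith
  exact (mul_eq_zero.1 this).resolve_left ha.ne'

theorem isFaceOf_zeros {C : Set W} (hC : Convex ℝ C) (g : W →ᵃ[ℝ] ℝ) (hg : ∀ x ∈ C, 0 ≤ g x) :
    IsFaceOf C {x ∈ C | g x = 0} := by
  refine ⟨?_, isExtreme_zeros g hg⟩
  rintro x ⟨hx, hx0⟩ y ⟨hy, hy0⟩ a b ha hb hab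
  refine ⟨hC hx hy ha hb hab, ?_⟩
  rw [Convex.combo_affine_apply hab, hx0, hy0]
  simp

theorem IsFaceOf.trans {C F G : Set W} (h : IsFaceOf C F) (h' : IsFaceOf F G) : IsFaceOf C G :=
  ⟨h'.1, h.2.trans h'.2⟩

theorem IsFaceOf.inter_of_subset {C D F : Set W} (h : IsFaceOf C F) (hD : D ⊆ C)
    (hDc : Convex ℝ D) : IsFaceOf D (D ∩ F) := by
  refine ⟨hDc.inter h.1, inter_subset_left, ?_⟩
  rintro x hx y hy z ⟨_, hz⟩ hxy
  exact ⟨hx, h.2.left_mem_of_mem_openSegment (hD hx) (hD hy) hz hxy⟩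

theorem IsFaceOf.image {V : Type*} [AddCommGroup V] [Module ℝ V] {C F : Set V}
    (h : IsFaceOf C F) {j : V →ₗ[ℝ] W} (hj : Function.Injective j) :
    IsFaceOf (j '' C) (j '' F) := by
  refine ⟨h.1.linear_image j, image_mono h.2.subset, ?_⟩
  rintro _ ⟨x, hx, rfl⟩ _ ⟨y, hy, rfl⟩ _ ⟨z, hz, rfl⟩ ⟨a, b, ha, hb, hab, hxy⟩
  refine ⟨x, h.2.left_mem_of_mem_openSegment hx hy hz ⟨a, b, ha, hb, hab, hj ?_⟩, rfl⟩
  simpa using hxy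

theorem IsFaceOf.preimage {V : Type*} [AddCommGroup V] [Module ℝ V] {C : Set V} {F : Set W}
    {j : V →ₗ[ℝ] W} (hj : Function.Injective j) (h : IsFaceOf (j '' C) F) :
    IsFaceOf C (j ⁻¹' F) := by
  refine ⟨h.1.linear_preimage j, ?_, ?_⟩
  · intro x hx
    obtain ⟨y, hy, hyx⟩ := h.2.subset hx
    rwa [← hj hyx]
  · rintro x hx y hy z hz ⟨a, b, ha, hb, hab, rfl⟩
    refine h.2.left_mem_of_mem_openSegment (mem_image_of_mem j hx) (mem_image_of_mem j hy) hz
      ⟨a, b, ha, hb, hab, by simp⟩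

theorem sub_smul_mem_vectorSpan {S : Set W} {u : Dual ℝ W} (hS : ∀ x ∈ S, u x = 1) {p φ : W}
    (hp : p ∈ S) (hφ : φ ∈ Submodule.span ℝ S) : φ - u φ • p ∈ vectorSpan ℝ S := by
  induction hφ using Submodule.span_induction with
  | mem x hx =>
    rw [hS x hx, one_smul]
    exact vsub_mem_vectorSpan ℝ hx hp
  | zero => simp
  | add x y _ _ hx hy =>
    convert add_mem hx hy using 1
    rw [map_add]
    module
  | smul r x _ hx =>
    convert Submodule.smul_mem _ r hx using 1
    rw [map_smul, smul_sub, smul_smul, smul_eq_mul]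

theorem vectorSpan_le_span (S : Set W) : vectorSpan ℝ S ≤ Submodule.span ℝ S := by
  rw [vectorSpan_def, Submodule.span_le]
  rintro _ ⟨x, hx, y, hy, rfl⟩
  exact sub_mem (Submodule.subset_span hx) (Submodule.subset_span hy)

theorem vectorSpan_eq_span_inf_ker {S : Set W} {u : Dual ℝ W} (hS : ∀ x ∈ S, u x = 1) :
    vectorSpan ℝ S = Submodule.span ℝ S ⊓ LinearMap.ker u := by
  refine le_antisymm (le_inf (vectorSpan_le_span S) ?_) ?_
  · rw [vectorSpan_def, Submodule.span_le]
    rintro _ ⟨x, hx, y, hy, rfl⟩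
    simp [hS x hx, hS y hy]
  · rintro φ ⟨hφ, hu⟩
    rcases S.eq_empty_or_nonempty with rfl | ⟨p, hp⟩
    · simpa using hφ
    · simpa [LinearMap.mem_ker.1 hu] using sub_smul_mem_vectorSpan hS hp hφ

/-- The span of the differences of a convex set consists of the multiples of differences. -/
theorem exists_smul_eq_sub_of_mem_vectorSpan {C : Set W} (hC : Convex ℝ C) (hne : C.Nonempty)
    {v : W} (hv : v ∈ vectorSpan ℝ C) :
    ∃ t : ℝ, 0 < t ∧ ∃ x ∈ C, ∃ y ∈ C, t • v = x - y := by
  obtain ⟨p, hp⟩ := hne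
  rw [vectorSpan_def] at hv
  induction hv using Submodule.span_induction with
  | mem z hz =>
    obtain ⟨x, hx, y, hy, rfl⟩ := hz
    exact ⟨1, one_pos, x, hx, y, hy, by simp⟩
  | zero => exact ⟨1, one_pos, p, hp, p, hp, by simp⟩
  | add v w _ _ hv hw =>
    obtain ⟨t, ht, x, hx, y, hy, h⟩ := hv
    obtain ⟨t', ht', x', hx', y', hy', h'⟩ := hw
    -- The convex weights `t' / (t + t')` and `t / (t + t')` bring `t • v` and `t' • w` to the
    -- common factor `t * t' / (t + t')`.
    have hs : 0 < t + t' := by positivity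
    refine ⟨t * t' / (t + t'), by positivity, (t' / (t + t')) • x + (t / (t + t')) • x',
      hC hx hx' (by positivity) (by positivity) (by field_simp; ring),
      (t' / (t + t')) • y + (t / (t + t')) • y',
      hC hy hy' (by positivity) (by positivity) (by field_simp; ring), ?_⟩
    have e1 : (t * t' / (t + t')) • v = (t' / (t + t')) • (t • v) := by
      rw [smul_smul]; congr 1; ring
    have e2 : (t * t' / (t + t')) • w = (t / (t + t')) • (t' • w) := by
      rw [smul_smul]; congr 1; ring
    rw [smul_add, e1, e2, h, h']
    module
  | smul r v _ hv =>
    obtain ⟨t, ht, x, hx, y, hy, h⟩ := hv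
    rcases lt_trichotomy r 0 with hr | rfl | hr
    · refine ⟨t / -r, div_pos ht (neg_pos.2 hr), y, hy, x, hx, ?_⟩
      rw [smul_smul, ← neg_sub x y, ← h, ← neg_smul]
      congr 1
      have := hr.ne
      field_simp
    · exact ⟨1, one_pos, p, hp, p, hp, by simp⟩
    · refine ⟨t / r, by positivity, x, hx, y, hy, ?_⟩
      rw [smul_smul, ← h]
      congr 1
      field_simp

/-- A point of `C` in the affine span of a face lies in the face. -/
theorem IsFaceOf.mem_of_sub_mem_vectorSpan {C F : Set W} (h : IsFaceOf C F) {p q : W}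
    (hp : p ∈ F) (hq : q ∈ C) (hpq : q - p ∈ vectorSpan ℝ F) : q ∈ F := by
  obtain ⟨t, ht, x, hx, y, hy, hxy⟩ := exists_smul_eq_sub_of_mem_vectorSpan h.1 ⟨p, hp⟩ hpq
  -- As `x = y + t (q - p)`, this point of `F` is also `(y + t q) / (1 + t)`, which lies strictly
  -- between `q` and `y`.
  have hz : (1 / (1 + t)) • x + (t / (1 + t)) • p ∈ F :=
    h.1 hx hp (by positivity) (by positivity) (by field_simp)
  refine h.2.left_mem_of_mem_openSegment hq (h.2.subset hy) hz
    ⟨t / (1 + t), 1 / (1 + t), by positivity, by positivity, by field_simp; ring, ?_⟩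
  rw [show x = y + t • (q - p) by rw [hxy]; abel]
  module

end Polyhedra

/-! ### The bending function and its affinity loci in a polyhedron. -/

section Bending

variable {W : Type*} [AddCommGroup W] [Module ℝ W]

/-- The concave function on `W` that bends along the hyperplanes `a = 0`, for `a ∈ A`. -/
def bend (A : Finset (Dual ℝ W)) (v : W) : ℝ := -∑ a ∈ A, |a v|

open Classical in
/-- `1` if `a ∈ s` and `-1` otherwise. -/
def sgn (s : Finset (Dual ℝ W)) (a : Dual ℝ W) : ℝ := if a ∈ s then 1 else -1

/-- A linear function that lies above `bend A` and agrees with it where the signs of the functions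
in `A` are given by `s`. -/
def chamberFn (A s : Finset (Dual ℝ W)) : Dual ℝ W := -∑ a ∈ A, sgn s a • a

theorem chamberFn_apply (A s : Finset (Dual ℝ W)) (v : W) :
    chamberFn A s v = -∑ a ∈ A, sgn s a * a v := by
  simp [chamberFn, LinearMap.sum_apply]

theorem sgn_mul_le (s : Finset (Dual ℝ W)) (a : Dual ℝ W) (v : W) : sgn s a * a v ≤ |a v| := by
  unfold sgn
  split_ifs
  · simpa using le_abs_self _
  · simpa using neg_le_abs _

theorem bend_le_chamberFn (A s : Finset (Dual ℝ W)) (v : W) : bend A v ≤ chamberFn A s v := by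
  rw [chamberFn_apply]
  exact neg_le_neg (Finset.sum_le_sum fun a _ => sgn_mul_le s a v)

theorem bend_eq_chamberFn_iff (A s : Finset (Dual ℝ W)) (v : W) :
    bend A v = chamberFn A s v ↔ ∀ a ∈ A, sgn s a * a v = |a v| := by
  rw [chamberFn_apply, bend, neg_inj, eq_comm,
    Finset.sum_eq_sum_iff_of_le fun a _ => sgn_mul_le s a v]

theorem exists_chamberFn_eq (A : Finset (Dual ℝ W)) (v : W) :
    ∃ s ⊆ A, bend A v = chamberFn A s v := by
  classical
  refine ⟨{a ∈ A | 0 ≤ a v}, Finset.filter_subset _ _, ?_⟩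
  rw [bend_eq_chamberFn_iff]
  intro a ha
  by_cases h : 0 ≤ a v
  · simp [sgn, ha, h, abs_of_nonneg h]
  · simp [sgn, h, abs_of_neg (not_le.1 h)]

/-- Exhibits `bend A` as a minimum of finitely many linear functions; both its concavity and the
polyhedrality of its hypograph come from this. -/
theorem le_bend_iff (A : Finset (Dual ℝ W)) (v : W) (t : ℝ) :
    t ≤ bend A v ↔ ∀ s ∈ A.powerset, t ≤ chamberFn A s v := by
  refine ⟨fun h s _ => h.trans (bend_le_chamberFn A s v), fun h => ?_⟩
  obtain ⟨s, hs, e⟩ := exists_chamberFn_eq A v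
  exact e ▸ h s (Finset.mem_powerset.2 hs)

theorem concaveOn_bend (A : Finset (Dual ℝ W)) : ConcaveOn ℝ univ (bend A) := by
  refine ⟨convex_univ, fun x _ y _ a b ha hb hab => ?_⟩
  rw [le_bend_iff]
  intro s _
  rw [map_add, map_smul, map_smul]
  exact add_le_add (smul_le_smul_of_nonneg_left (bend_le_chamberFn A s x) ha)
    (smul_le_smul_of_nonneg_left (bend_le_chamberFn A s y) hb)

/-- If `bend A` is linear on a convex set, then the functions in `A` have constant signs on it. -/
theorem exists_chamberFn_eqOn (A : Finset (Dual ℝ W)) {D : Set W} (hD : Convex ℝ D)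
    {l : Dual ℝ W} (hl : ∀ v ∈ D, bend A v = l v) :
    ∃ s ⊆ A, ∀ v ∈ D, bend A v = chamberFn A s v := by
  classical
  refine ⟨{a ∈ A | ∀ v ∈ D, 0 ≤ a v}, Finset.filter_subset _ _, fun v hv => ?_⟩
  rw [bend_eq_chamberFn_iff]
  intro a ha
  by_cases h : ∀ v ∈ D, 0 ≤ a v
  · rw [sgn, if_pos (Finset.mem_filter.2 ⟨ha, h⟩), one_mul, abs_of_nonneg (h v hv)]
  · have hs : a ∉ ({a ∈ A | ∀ v ∈ D, 0 ≤ a v} : Finset (Dual ℝ W)) := by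
      simp only [Finset.mem_filter, not_and]
      exact fun _ => h
    rw [sgn, if_neg hs]
    push Not at h
    obtain ⟨w, hw, haw⟩ := h
    suffices a v ≤ 0 by rw [abs_of_nonpos this]; ring
    by_contra! hav
    -- If `a` had opposite signs at `v` and `w`, the triangle inequality for `|a|` would be strict
    -- at the midpoint, against linearity of `bend A` on `D`.
    have hm : (2⁻¹ : ℝ) • v + (2⁻¹ : ℝ) • w ∈ D :=
      hD hv hw (by norm_num) (by norm_num) (by norm_num)
    have h1 := hl _ hm
    rw [map_add, map_smul, map_smul, ← hl v hv, ← hl w hw] at h1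
    simp only [bend, map_add, map_smul, smul_eq_mul] at h1
    have h2 : ∑ b ∈ A, |2⁻¹ * b v + 2⁻¹ * b w| < ∑ b ∈ A, (2⁻¹ * |b v| + 2⁻¹ * |b w|) := by
      refine Finset.sum_lt_sum (fun b _ => ?_) ⟨a, ha, ?_⟩
      · refine (abs_add_le _ _).trans_eq ?_
        rw [abs_mul, abs_mul, abs_of_pos (by norm_num : (0 : ℝ) < 2⁻¹)]
      · rw [abs_of_pos hav, abs_of_neg haw, abs_lt]
        constructor <;> linarith
    rw [Finset.sum_add_distrib, ← Finset.mul_sum, ← Finset.mul_sum] at h2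
    linarith

/-- The locus in `C` where the linear function `l` touches `bend A` from above. -/
def touching (A : Finset (Dual ℝ W)) (C : Set W) (l : Dual ℝ W) : Set W :=
  {v ∈ C | bend A v = l v}

/-- The affinity loci of the restriction of `bend A` to `C`. -/
def IsLocus (A : Finset (Dual ℝ W)) (C D : Set W) : Prop :=
  ∃ l : Dual ℝ W, (∀ v ∈ C, bend A v ≤ l v) ∧ D = touching A C l

variable {A : Finset (Dual ℝ W)} {C D : Set W}

/-- Where `l` dominates `bend A`, touching means `l ≤ bend A`, which amounts to finitely many linear
inequalities. -/
theorem IsPolyhedron.touching (hC : IsPolyhedron C) {l : Dual ℝ W}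
    (hl : ∀ v ∈ C, bend A v ≤ l v) : IsPolyhedron (touching A C l) := by
  convert hC.inter
    (isPolyhedron_of_finset A.powerset fun s => (chamberFn A s - l).toAffineMap) using 1
  ext v
  refine and_congr_right fun hv => ?_
  rw [← (hl v hv).ge_iff_eq, le_bend_iff]
  simp

theorem IsLocus.isPolyhedron (hC : IsPolyhedron C) (h : IsLocus A C D) : IsPolyhedron D := by
  obtain ⟨l, hl, rfl⟩ := h
  exact hC.touching hl

theorem isLocus_chamberFn (s : Finset (Dual ℝ W)) :
    IsLocus A C (touching A C (chamberFn A s)) :=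
  ⟨_, fun v _ => bend_le_chamberFn A s v, rfl⟩

/-- An affine function on the hyperplane `u = 1` extends to a linear function. -/
theorem exists_linear_eq (u : Dual ℝ W) (g : W →ᵃ[ℝ] ℝ) :
    ∃ a : Dual ℝ W, ∀ v, u v = 1 → g v = a v := by
  refine ⟨g.linear + g 0 • u, fun v hv => ?_⟩
  have := congrFun g.decomp v
  simp only [Pi.add_apply] at this
  simp [hv, this]

/-- The graph of `l` over `D` is a face of the hypograph, and the part over `G` is a face of that
face, hence of the hypograph. The hypograph is a polyhedron, so some affine `g` exposes this part;
`g` is not vertical, and solving `g = 0` for the last coordinate gives the linear function that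
touches exactly along `G`. The empty face is treated apart. -/
theorem IsLocus.of_isFaceOf {u : Dual ℝ W} (hu : ∀ v ∈ C, u v = 1) (hC : IsPolyhedron C)
    (hD : IsLocus A C D) {G : Set W} (hG : IsFaceOf D G) : IsLocus A C G := by
  rcases G.eq_empty_or_nonempty with rfl | ⟨p, hp⟩
  -- The height is `1` on `C` while `bend A ≤ 0`, so it dominates without touching.
  · have h : ∀ v ∈ C, bend A v < u v := fun v hv => by
      rw [hu v hv]
      have : 0 ≤ ∑ a ∈ A, |a v| := Finset.sum_nonneg fun _ _ => abs_nonneg _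
      exact (neg_nonpos.2 this).trans_lt one_pos
    refine ⟨u, fun v hv => (h v hv).le, ?_⟩
    ext v
    simp only [mem_empty_iff_false, false_iff]
    exact fun hv => (h v hv.1).ne hv.2
  obtain ⟨l, hl, rfl⟩ := hD
  -- The hypograph of `bend A` over `C`, with the faces lying over `D` and over `G`.
  set hyp : Set (W × ℝ) := {x | x.1 ∈ C ∧ x.2 ≤ bend A x.1} with hhyp
  have hypoly : IsPolyhedron hyp := by
    convert (hC.preimage (LinearMap.fst ℝ W ℝ).toAffineMap).inter
      (isPolyhedron_of_finset A.powerset fun s => ((chamberFn A s).comp (LinearMap.fst ℝ W ℝ) -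
        LinearMap.snd ℝ W ℝ).toAffineMap) using 1
    ext x
    refine and_congr_right fun hx => ?_
    rw [le_bend_iff]
    simp
  let lin : W × ℝ →ᵃ[ℝ] ℝ := (l.comp (LinearMap.fst ℝ W ℝ) - LinearMap.snd ℝ W ℝ).toAffineMap
  have hlin : ∀ x, lin x = l x.1 - x.2 := fun x => rfl
  have hface : IsFaceOf hyp {x ∈ hyp | lin x = 0} := by
    refine isFaceOf_zeros hypoly.convex lin fun x hx => ?_
    have := hl _ hx.1
    have := hx.2
    rw [hlin]
    linarith
  have hmem : ∀ x, x ∈ {x ∈ hyp | lin x = 0} ↔ x.1 ∈ touching A C l ∧ x.2 = l x.1 := by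
    intro x
    simp only [mem_ofPred_eq, hlin, hhyp, touching]
    constructor
    · rintro ⟨⟨h1, h2⟩, h3⟩
      have := hl _ h1
      exact ⟨⟨h1, by linarith⟩, by linarith⟩
    · rintro ⟨⟨h1, h2⟩, h3⟩
      exact ⟨⟨h1, by linarith⟩, by linarith⟩
  have hface' : IsFaceOf {x ∈ hyp | lin x = 0} {x | x.1 ∈ G ∧ x.2 = l x.1} := by
    refine ⟨?_, fun x hx => (hmem x).2 ⟨hG.2.subset hx.1, hx.2⟩, ?_⟩
    · rintro x ⟨hx, hx'⟩ y ⟨hy, hy'⟩ a b ha hb hab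
      exact ⟨hG.1 hx hy ha hb hab, by simp [hx', hy']⟩
    · rintro x hx y hy z hz ⟨a, b, ha, hb, hab, rfl⟩
      rw [hmem] at hx hy
      exact ⟨hG.2.left_mem_of_mem_openSegment hx.1 hy.1 hz.1 ⟨a, b, ha, hb, hab, rfl⟩, hx.2⟩
  obtain ⟨g, hg, hgG⟩ := hypoly.exists_exposing (hface.trans hface') ⟨(p, l p), hp, rfl⟩
  have hgdec : ∀ v t, g (v, t) = g (v, 0) - (-g.linear (0, 1)) * t := by
    intro v t
    have h1 : ((v, t) : W × ℝ) = t • ((0, 1) : W × ℝ) +ᵥ ((v, 0) : W × ℝ) := by ext <;> simp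
    rw [h1, g.map_vadd, map_smul]
    simp only [vadd_eq_add, smul_eq_mul]
    ring
  set κ := -g.linear (0, 1) with hκ
  have hGC : ∀ v ∈ G, v ∈ C ∧ bend A v = l v := fun v hv => hG.2.subset hv
  have hp0 : g (p, l p) = 0 := by
    have : (p, l p) ∈ {x ∈ hyp | g x = 0} := hgG ▸ ⟨hp, rfl⟩
    exact this.2
  -- The point one unit below the graph at `p` lies in the hypograph but not on the exposed face, so
  -- `g` is positive there.
  have hκpos : 0 < κ := by
    have hmem' : ((p, l p - 1) : W × ℝ) ∈ hyp := ⟨(hGC p hp).1, by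
      have := (hGC p hp).2
      simp only
      linarith⟩
    have h1 := hg _ hmem'
    have h2 : g (p, l p - 1) ≠ 0 := fun h => by
      have : ((p, l p - 1) : W × ℝ) ∈ {x | x.1 ∈ G ∧ x.2 = l x.1} := hgG ▸ ⟨hmem', h⟩
      have := this.2
      simp at this
    rw [hgdec] at h1 h2 hp0
    have := lt_of_le_of_ne h1 (Ne.symm h2)
    linarith
  -- Over `C`, `l'` is the function whose graph is the zero set of `g`.
  obtain ⟨l', hl'⟩ := exists_linear_eq u
    ((κ⁻¹ • g).comp (LinearMap.inl ℝ W ℝ).toAffineMap)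
  have hl'' : ∀ v ∈ C, ∀ t, g (v, t) = κ * (l' v - t) := by
    intro v hv t
    rw [hgdec, ← hl' v (hu v hv)]
    have h1 : ((κ⁻¹ • g).comp (LinearMap.inl ℝ W ℝ).toAffineMap) v = κ⁻¹ * g (v, 0) := rfl
    rw [h1]
    field_simp
  refine ⟨l', fun v hv => ?_, ?_⟩
  · have := hg (v, bend A v) ⟨hv, le_rfl⟩
    rw [hl'' v hv] at this
    linarith [nonneg_of_mul_nonneg_right this hκpos]
  · ext v
    constructor
    · intro hv
      have hv' := hGC v hv
      have : (v, l v) ∈ {x ∈ hyp | g x = 0} := hgG ▸ ⟨hv, rfl⟩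
      have h0 := this.2
      rw [hl'' v hv'.1, mul_eq_zero] at h0
      refine ⟨hv'.1, ?_⟩
      have := h0.resolve_left hκpos.ne'
      linarith [hv'.2]
    · rintro ⟨hv, hv'⟩
      have : (v, bend A v) ∈ {x | x.1 ∈ G ∧ x.2 = l x.1} := by
        rw [hgG]
        exact ⟨⟨hv, le_rfl⟩, by rw [hl'' v hv, hv']; ring⟩
      exact this.1

/-- The functions in `A` have constant signs on `D`, so `bend A` agrees there with a single
`chamberFn A s`. On the chamber of `s` the difference `l - chamberFn A s` is nonnegative, with zero
set `D`. -/
theorem IsLocus.exists_chamber (hC : IsPolyhedron C) (hD : IsLocus A C D) :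
    ∃ s ∈ A.powerset, IsFaceOf (touching A C (chamberFn A s)) D := by
  have hDc := (hD.isPolyhedron hC).convex
  obtain ⟨l, hl, rfl⟩ := hD
  obtain ⟨s, hs, h⟩ := exists_chamberFn_eqOn A hDc fun v hv => hv.2
  refine ⟨s, Finset.mem_powerset.2 hs, ?_⟩
  have key := isFaceOf_zeros (hC.touching fun v _ => bend_le_chamberFn A s v).convex
    (l - chamberFn A s).toAffineMap fun v hv => by
      have := hl v hv.1
      have := hv.2
      simp only [LinearMap.coe_toAffineMap, LinearMap.sub_apply]
      linarith
  convert key using 1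
  ext v
  simp only [LinearMap.coe_toAffineMap, LinearMap.sub_apply, mem_ofPred_eq]
  constructor
  · intro hv
    have := hv.2
    have := h v hv
    exact ⟨⟨hv.1, this⟩, by linarith⟩
  · rintro ⟨⟨hv, h1⟩, h2⟩
    exact ⟨hv, by linarith⟩

theorem IsPolyhedron.finite_loci (hC : IsPolyhedron C) : {D | IsLocus A C D}.Finite := by
  refine (A.powerset.finite_toSet.biUnion fun s _ =>
    (hC.touching fun v _ => bend_le_chamberFn A s v).finite_faces).subset fun D hD => ?_
  obtain ⟨s, hs, h⟩ := IsLocus.exists_chamber hC hD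
  exact mem_biUnion (Finset.mem_coe.2 hs) h

end Bending

theorem mem_affineSpan_iff_of_eq_one {W : Type*} [AddCommGroup W] [Module ℝ W] {S : Set W}
    {u : Dual ℝ W} (hS : ∀ x ∈ S, u x = 1) {φ : W} :
    φ ∈ affineSpan ℝ S ↔ φ ∈ Submodule.span ℝ S ∧ u φ = 1 := by
  constructor
  · intro h
    obtain ⟨p, hp⟩ := (affineSpan_nonempty (k := ℝ) (s := S)).1 ⟨φ, h⟩
    have h' := vsub_mem_vectorSpan_of_mem_affineSpan_of_mem_affineSpan h (mem_affineSpan ℝ hp)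
    rw [vectorSpan_eq_span_inf_ker hS] at h'
    obtain ⟨h1, h2⟩ := h'
    refine ⟨?_, ?_⟩
    · simpa using add_mem h1 (Submodule.subset_span hp)
    · have : u φ - u p = 0 := by rw [← map_sub]; exact h2
      rw [← hS p hp]
      linarith
  · rintro ⟨h1, h2⟩
    rcases S.eq_empty_or_nonempty with rfl | ⟨p, hp⟩
    · rw [Submodule.span_empty, Submodule.mem_bot] at h1
      simp [h1] at h2
    · have := sub_smul_mem_vectorSpan hS hp h1
      rw [h2, one_smul] at this
      simpa using vadd_mem_affineSpan_of_mem_affineSpan_of_mem_vectorSpan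
        (mem_affineSpan ℝ hp) this

/-! ### Function spaces pulled back from `N`, compared with images in `N`. -/

section Pullback

variable {X : Type*} {N : Type*} [AddCommGroup N] [Module ℝ N]

/-- The map that pulls a linear function on `N` back to the subset `σ` of `X`. -/
def pullbackMap (ι : X → N) (σ : Set X) : Dual ℝ N →ₗ[ℝ] (σ → ℝ) where
  toFun a x := a (ι x)
  map_add' _ _ := rfl
  map_smul' _ _ := rfl

/-- The space of functions on `σ` that are induced by linear functions on `N`. -/
def pullback (ι : X → N) (σ : Set X) : Submodule ℝ (σ → ℝ) := LinearMap.range (pullbackMap ι σ)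

theorem mem_pullback {ι : X → N} {σ : Set X} {m : σ → ℝ} :
    m ∈ pullback ι σ ↔ ∃ a : Dual ℝ N, ∀ x : σ, m x = a (ι x) :=
  ⟨fun ⟨a, h⟩ => ⟨a, fun x => (congrFun h x).symm⟩, fun ⟨a, h⟩ => ⟨a, (funext h).symm⟩⟩

theorem comp_inclusion_mem_pullback {ι : X → N} {σ τ : Set X} (h : τ ⊆ σ) {m : σ → ℝ}
    (hm : m ∈ pullback ι σ) : m ∘ inclusion h ∈ pullback ι τ := by
  obtain ⟨a, ha⟩ := mem_pullback.1 hm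
  exact mem_pullback.2 ⟨a, fun x => ha _⟩

/-- The pullback of linear functions, as a map onto `pullback ι σ`. -/
def toPullback (ι : X → N) (σ : Set X) : Dual ℝ N →ₗ[ℝ] pullback ι σ :=
  (pullbackMap ι σ).rangeRestrict

theorem toPullback_surjective (ι : X → N) (σ : Set X) : Function.Surjective (toPullback ι σ) :=
  (pullbackMap ι σ).surjective_rangeRestrict

/-- A functional on the dual is evaluation at some `m`; if it kills all evaluation points, then `m`
vanishes pointwise. -/
theorem span_range_ev {S : Type*} (M : Submodule ℝ (S → ℝ)) [FiniteDimensional ℝ M] :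
    Submodule.span ℝ (range (ev M)) = ⊤ := by
  by_contra h
  obtain ⟨g, hg, hle⟩ := Submodule.exists_le_ker_of_lt_top _ (lt_top_iff_ne_top.2 h)
  obtain ⟨m, rfl⟩ := (evalEquiv ℝ M).surjective g
  refine hg ?_
  have : m = 0 := by
    ext x
    exact hle (Submodule.subset_span ⟨x, rfl⟩)
  rw [this, map_zero]

variable [FiniteDimensional ℝ N]

instance (ι : X → N) (σ : Set X) : FiniteDimensional ℝ (pullback ι σ) :=
  LinearMap.finiteDimensional_range _

/-- The linear embedding of the dual of `pullback ι σ` into `N`. -/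
def dualEmb (ι : X → N) (σ : Set X) : Dual ℝ (pullback ι σ) →ₗ[ℝ] N :=
  (evalEquiv ℝ N).symm.toLinearMap ∘ₗ (toPullback ι σ).dualMap

theorem apply_dualEmb (ι : X → N) (σ : Set X) (a : Dual ℝ N) (φ : Dual ℝ (pullback ι σ)) :
    a (dualEmb ι σ φ) = φ (toPullback ι σ a) := by
  exact apply_evalEquiv_symm_apply ℝ N a _

theorem dualEmb_injective (ι : X → N) (σ : Set X) : Function.Injective (dualEmb ι σ) := by
  intro φ ψ h
  ext m
  obtain ⟨a, rfl⟩ := toPullback_surjective ι σ m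
  rw [← apply_dualEmb, ← apply_dualEmb, h]

theorem dualEmb_ev (ι : X → N) (σ : Set X) (x : σ) :
    dualEmb ι σ (ev (pullback ι σ) x) = ι x := by
  rw [← sub_eq_zero, ← forall_dual_apply_eq_zero_iff ℝ]
  intro a
  rw [map_sub, apply_dualEmb, sub_eq_zero]
  rfl

theorem dualEmb_image (ι : X → N) (σ : Set X) :
    dualEmb ι σ '' range (ev (pullback ι σ)) = ι '' σ := by
  rw [← range_comp, image_eq_range]
  exact congrArg range (funext fun x => dualEmb_ev ι σ x)

/-- `dualEmb` carries the chart onto `ι '' σ`, so questions about faces can be settled in `N`;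
injectivity of `ι` recovers `τ` from its image. -/
theorem isCellFace_pullback_iff {ι : X → N} {σ τ : Set X} (hι : InjOn ι σ) :
    IsCellFace σ (pullback ι σ) τ ↔ τ ⊆ σ ∧ IsFaceOf (ι '' σ) (ι '' τ) := by
  constructor
  · rintro ⟨F, hF, rfl⟩
    refine ⟨Subtype.coe_image_subset _ _, ?_⟩
    convert hF.image (dualEmb_injective ι σ) using 1
    · rw [dualEmb_image]
    · ext v
      constructor
      · rintro ⟨_, ⟨x, hx, rfl⟩, rfl⟩
        exact ⟨_, hx, dualEmb_ev ι σ x⟩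
      · rintro ⟨φ, hφ, rfl⟩
        obtain ⟨x, rfl⟩ := hF.2.subset hφ
        exact ⟨x, ⟨x, hφ, rfl⟩, (dualEmb_ev ι σ x).symm⟩
  · rintro ⟨hτ, h⟩
    rw [← dualEmb_image ι σ] at h
    refine ⟨_, h.preimage (dualEmb_injective ι σ), ?_⟩
    ext x
    constructor
    · intro hx
      refine ⟨⟨x, hτ hx⟩, ?_, rfl⟩
      rw [mem_preimage, mem_preimage, dualEmb_ev]
      exact mem_image_of_mem ι hx
    · rintro ⟨x, hx, rfl⟩
      rw [mem_preimage, mem_preimage, dualEmb_ev] at hx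
      obtain ⟨y, hy, hyx⟩ := hx
      rwa [← hι (hτ hy) x.2 hyx]

theorem finrank_pullback (ι : X → N) (σ : Set X) :
    finrank ℝ (pullback ι σ) = finrank ℝ (Submodule.span ℝ (ι '' σ)) := by
  rw [← Subspace.dual_finrank_eq, ← dualEmb_image, Submodule.span_image, span_range_ev,
    Submodule.map_top, LinearMap.finrank_range_of_inj (dualEmb_injective ι σ)]

end Pullback

/-! ### Subdivisions, and the function spaces of adapted structures. -/

section Subdivision

namespace PolyhedralStructure

variable {X : Type*} [TopologicalSpace X] {N : Type*} [AddCommGroup N] [Module ℝ N]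
  {ι : X → N} {u : Dual ℝ N} {P : PolyhedralStructure X}

theorem isAffineOn_ev_inclusion {P' : PolyhedralStructure X} {σ' σ : Set X} (h : σ' ⊆ σ)
    (hM : ∀ m ∈ P.M σ, m ∘ inclusion h ∈ P'.M σ') :
    P'.IsAffineOn σ' (fun x : σ' => ev (P.M σ) (inclusion h x)) := by
  let R : P.M σ →ₗ[ℝ] P'.M σ' := (LinearMap.funLeft ℝ ℝ (inclusion h)).restrict hM
  exact ⟨R.dualMap.toAffineMap, fun x => rfl⟩

theorem IsSubdivision.trans {P₁ P₂ P₃ : PolyhedralStructure X} (h : P₁.IsSubdivision P₂)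
    (h' : P₂.IsSubdivision P₃) : P₁.IsSubdivision P₃ := by
  intro σ₁ hσ₁
  obtain ⟨σ₂, hσ₂, h₁₂, L, hL⟩ := h σ₁ hσ₁
  obtain ⟨σ₃, hσ₃, h₂₃, L', hL'⟩ := h' σ₂ hσ₂
  refine ⟨σ₃, hσ₃, h₁₂.trans h₂₃, L'.comp L, fun x => ?_⟩
  rw [AffineMap.comp_apply, ← hL, ← hL']

theorem Adapted.of_isSubdivision (hP : P.Adapted ι) {Q : PolyhedralStructure X}
    (h : Q.IsSubdivision P) : Q.Adapted ι := by
  intro σ' hσ'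
  obtain ⟨σ, hσ, hsub, L, hL⟩ := h σ' hσ'
  obtain ⟨⟨L', hL'⟩, hinj⟩ := hP σ hσ
  refine ⟨⟨L'.comp L, fun x => ?_⟩, hinj.mono hsub⟩
  rw [AffineMap.comp_apply, ← hL, ← hL']

/-- The chart provides the constant function `1` in `P.M σ`, which turns the affine map `L` into a
linear map `L'` into `N`. It is injective, so a left inverse extends every element of `P.M σ` to a
linear function on `N`. Conversely, a linear function composed with `L'` lies in the bidual, so it
is evaluation at an element of `P.M σ`. -/
theorem Adapted.M_eq (hP : P.Adapted ι) (hu : ∀ x, u (ι x) = 1) {σ : Set X} (hσ : σ ∈ P.cells) :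
    P.M σ = pullback ι σ := by
  obtain ⟨⟨L, hL⟩, hinj⟩ := hP σ hσ
  have hch := P.chart σ hσ
  have := hch.finiteDimensional
  obtain ⟨e, he⟩ := hch.fullDimensional
  have hev : ∀ φ ∈ range (ev (P.M σ)), Dual.eval ℝ _ e φ = 1 := fun φ hφ =>
    he.subset (mem_affineSpan ℝ hφ)
  have he1 : ∀ x, (e : σ → ℝ) x = 1 := fun x => hev _ ⟨x, rfl⟩
  -- A linear map that agrees with `L` on the polyhedron.
  let L' : Dual ℝ (P.M σ) →ₗ[ℝ] N := L.linear + (Dual.eval ℝ _ e).smulRight (L 0)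
  have hL' : ∀ x, L' (ev (P.M σ) x) = ι x := by
    intro x
    have h1 := congrFun L.decomp (ev (P.M σ) x)
    simp only [Pi.add_apply] at h1
    have hLx : ι x = L (ev (P.M σ) x) := hL x
    rw [hLx, h1]
    have h2 : (ev (P.M σ) x) e = 1 := he1 x
    simp [L', h2]
  have hspan : ∀ φ, φ ∈ Submodule.span ℝ (range (ev (P.M σ))) := fun φ => by
    rw [span_range_ev]
    trivial
  have huL : u ∘ₗ L' = Dual.eval ℝ _ e := by
    refine LinearMap.ext fun φ => ?_
    refine Submodule.span_induction ?_ ?_ ?_ ?_ (hspan φ)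
    · rintro _ ⟨x, rfl⟩
      rw [LinearMap.comp_apply, hL', hu, hev _ ⟨x, rfl⟩]
    · simp
    · intro x y _ _ hx hy
      rw [map_add, map_add, hx, hy]
    · intro r x _ hx
      rw [map_smul, map_smul, hx]
  have hinj' : Function.Injective L' := by
    rw [injective_iff_map_eq_zero]
    intro φ hφ
    rcases (range (ev (P.M σ))).eq_empty_or_nonempty with hemp | hne
    · have := hspan φ
      rw [hemp, Submodule.span_empty] at this
      exact this
    -- A vector killed by `L'` has height zero, so a positive multiple of it is a difference of two
    -- evaluation points. These have the same image under `ι`, hence coincide.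
    have hφ' : φ ∈ vectorSpan ℝ (range (ev (P.M σ))) := by
      rw [vectorSpan_eq_span_inf_ker hev]
      refine ⟨hspan φ, ?_⟩
      rw [SetLike.mem_coe, LinearMap.mem_ker, ← huL, LinearMap.comp_apply, hφ, map_zero]
    obtain ⟨t, ht, _, ⟨x, rfl⟩, _, ⟨y, rfl⟩, hxy⟩ :=
      exists_smul_eq_sub_of_mem_vectorSpan hch.isPolyhedron.convex hne hφ'
    have h0 : ι x = ι y := by
      rw [← hL', ← hL', ← sub_eq_zero, ← map_sub, ← hxy, map_smul, hφ, smul_zero]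
    rw [Subtype.ext (hinj x.2 y.2 h0), sub_self] at hxy
    exact (smul_eq_zero.1 hxy).resolve_left ht.ne'
  obtain ⟨r, hr⟩ := L'.exists_leftInverse_of_injective (LinearMap.ker_eq_bot.2 hinj')
  ext m
  rw [mem_pullback]
  constructor
  · intro hm
    refine ⟨(Dual.eval ℝ _ (⟨m, hm⟩ : P.M σ)) ∘ₗ r, fun x => ?_⟩
    have hrx := LinearMap.congr_fun hr (ev (P.M σ) x)
    rw [LinearMap.comp_apply, hL'] at hrx
    rw [LinearMap.comp_apply, hrx]
    rfl
  · rintro ⟨a, ha⟩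
    obtain ⟨m', hm'⟩ := (evalEquiv ℝ (P.M σ)).surjective (a ∘ₗ L')
    convert m'.2
    ext x
    rw [ha, ← hL', ← LinearMap.comp_apply, ← hm']
    rfl

end PolyhedralStructure

end Subdivision

/-! ### Charts and polyhedral structures built from embeddings into `N`. -/

section Topology

variable {X : Type*} [TopologicalSpace X] {N : Type*} [NormedAddCommGroup N] [NormedSpace ℝ N]
  [FiniteDimensional ℝ N]

theorem isInducing_dual : IsInducing fun (v : N) (a : Dual ℝ N) => a v := by
  let b := finBasis ℝ N
  have h : Continuous fun (v : N) (a : Dual ℝ N) => a v :=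
    continuous_pi fun a => a.continuous_of_finiteDimensional
  refine IsInducing.of_comp h (g := fun (w : Dual ℝ N → ℝ) i => w (b.coord i)) (by fun_prop) ?_
  exact b.equivFun.toContinuousLinearEquiv.toHomeomorph.isInducing

/-- Both maps become `x ↦ (a ↦ a (ι x))` after composition with an embedding: reindexing along the
surjection `toPullback` on one side, evaluation of vectors on the other. -/
theorem isEmbedding_ev_pullback_iff {ι : X → N} {σ : Set X} :
    IsEmbedding (fun (x : σ) (m : pullback ι σ) => ev (pullback ι σ) x m) ↔
      IsEmbedding (fun x : σ => ι x) := by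
  have hsurj := toPullback_surjective ι σ
  have hpre : IsEmbedding fun (w : pullback ι σ → ℝ) (a : Dual ℝ N) =>
      w (toPullback ι σ a) := by
    refine ⟨⟨?_⟩, fun w w' h => funext fun m => ?_⟩
    · simp only [Pi.topologicalSpace, induced_iInf, induced_compose]
      exact (hsurj.iInf_comp _).symm
    · obtain ⟨a, rfl⟩ := hsurj m
      exact congrFun h a
  have hdual : IsEmbedding fun (v : N) (a : Dual ℝ N) => a v :=
    ⟨isInducing_dual, fun v w h => by
      rw [← sub_eq_zero, ← forall_dual_apply_eq_zero_iff ℝ]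
      intro a
      rw [map_sub, sub_eq_zero]
      exact congrFun h a⟩
  rw [← hpre.of_comp_iff, ← hdual.of_comp_iff (f := fun x : σ => ι x)]
  rfl

theorem isPolyhedralChart_pullback {ι : X → N} {u : Dual ℝ N} {σ : Set X}
    (hu : ∀ x ∈ σ, u (ι x) = 1) (hι : IsEmbedding (fun x : σ => ι x))
    (hσ : IsPolyhedron (ι '' σ)) : IsPolyhedralChart (pullback ι σ) where
  finiteDimensional := inferInstance
  continuous := by
    rintro _ ⟨a, rfl⟩
    exact a.continuous_of_finiteDimensional.comp hι.continuous
  isEmbedding := isEmbedding_ev_pullback_iff.2 hι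
  isPolyhedron := by
    rw [← (dualEmb_injective ι σ).preimage_image (range (ev (pullback ι σ))), dualEmb_image]
    exact hσ.preimage (dualEmb ι σ).toAffineMap
  fullDimensional := by
    have h1 : ∀ φ ∈ range (ev (pullback ι σ)),
        Dual.eval ℝ _ (toPullback ι σ u) φ = 1 := by
      rintro _ ⟨x, rfl⟩
      exact hu x x.2
    refine ⟨toPullback ι σ u, ?_⟩
    ext φ
    rw [SetLike.mem_coe, mem_affineSpan_iff_of_eq_one h1, span_range_ev]
    exact and_iff_right trivial

namespace PolyhedralStructure

variable {ι : X → N} {u : Dual ℝ N} {P : PolyhedralStructure X}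

theorem Adapted.isEmbedding (hP : P.Adapted ι) (hu : ∀ x, u (ι x) = 1) {σ : Set X}
    (hσ : σ ∈ P.cells) : IsEmbedding (fun x : σ => ι x) := by
  have := (P.chart σ hσ).isEmbedding
  rw [hP.M_eq hu hσ] at this
  exact isEmbedding_ev_pullback_iff.1 this

theorem Adapted.isPolyhedron (hP : P.Adapted ι) (hu : ∀ x, u (ι x) = 1) {σ : Set X}
    (hσ : σ ∈ P.cells) : IsPolyhedron (ι '' σ) := by
  have := (P.chart σ hσ).isPolyhedron
  rw [hP.M_eq hu hσ] at this
  rw [← dualEmb_image]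
  exact this.image_of_injective (dualEmb_injective ι σ)

theorem Adapted.isCellFace_iff (hP : P.Adapted ι) (hu : ∀ x, u (ι x) = 1) {σ τ : Set X}
    (hσ : σ ∈ P.cells) :
    IsCellFace σ (P.M σ) τ ↔ τ ⊆ σ ∧ IsFaceOf (ι '' σ) (ι '' τ) := by
  rw [hP.M_eq hu hσ]
  exact isCellFace_pullback_iff (hP σ hσ).2

/-- A polyhedral structure given by a family of subsets that `ι` maps homeomorphically onto
polyhedra. -/
def ofFamily (ι : X → N) (u : Dual ℝ N) (hu : ∀ x, u (ι x) = 1) (cells : Set (Set X))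
    (isClosed : ∀ σ ∈ cells, IsClosed σ) (covers : ⋃₀ cells = univ)
    (locallyFinite : LocallyFinite (fun σ : cells => (σ : Set X)))
    (isEmbedding : ∀ σ ∈ cells, IsEmbedding (fun x : σ => ι x))
    (isPolyhedron : ∀ σ ∈ cells, IsPolyhedron (ι '' σ))
    (face_mem : ∀ σ ∈ cells, ∀ τ ⊆ σ, IsFaceOf (ι '' σ) (ι '' τ) → τ ∈ cells)
    (inter_face : ∀ σ ∈ cells, ∀ σ' ∈ cells, IsFaceOf (ι '' σ) (ι '' (σ ∩ σ'))) :
    PolyhedralStructure X where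
  cells := cells
  M := pullback ι
  isClosed := isClosed
  covers := covers
  locallyFinite := locallyFinite
  chart σ hσ := isPolyhedralChart_pullback (fun x _ => hu x) (isEmbedding σ hσ) (isPolyhedron σ hσ)
  face_mem σ hσ τ hτ := by
    rw [isCellFace_pullback_iff (injOn_iff_injective.2 (isEmbedding σ hσ).injective)] at hτ
    exact face_mem σ hσ τ hτ.1 hτ.2
  face_M σ hσ τ hτ g := by
    rw [isCellFace_pullback_iff (injOn_iff_injective.2 (isEmbedding σ hσ).injective)] at hτ
    rw [mem_pullback]
    constructor
    · rintro ⟨a, ha⟩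
      exact ⟨fun x => a (ι x), mem_pullback.2 ⟨a, fun _ => rfl⟩, fun x hx _ => ha ⟨x, hx⟩⟩
    · rintro ⟨m, hm, hgm⟩
      obtain ⟨a, ha⟩ := mem_pullback.1 hm
      exact ⟨a, fun x => by rw [hgm x x.2 (hτ.1 x.2), ha]⟩
  inter_face σ hσ σ' hσ' := by
    rw [isCellFace_pullback_iff (injOn_iff_injective.2 (isEmbedding σ hσ).injective),
      isCellFace_pullback_iff (injOn_iff_injective.2 (isEmbedding σ' hσ').injective)]
    refine ⟨⟨inter_subset_left, inter_face σ hσ σ' hσ'⟩, inter_subset_right, ?_⟩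
    rw [inter_comm]
    exact inter_face σ' hσ' σ hσ

end PolyhedralStructure

end Topology

/-! ### The subdivision of a complex by affinity loci. -/

section BendingSubdivision

variable {X : Type*} [TopologicalSpace X] {N : Type*} [NormedAddCommGroup N] [NormedSpace ℝ N]
  [FiniteDimensional ℝ N] {ι : X → N} {u : Dual ℝ N} {P : PolyhedralStructure X}

theorem continuous_bend (A : Finset (Dual ℝ N)) : Continuous (bend A) := by
  unfold bend
  have : ∀ a : Dual ℝ N, Continuous a := fun a => a.continuous_of_finiteDimensional
  fun_prop

namespace PolyhedralStructure

omit [FiniteDimensional ℝ N] in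
theorem Adapted.mem_affinityLoci_iff (hP : P.Adapted ι) (hu : ∀ x, u (ι x) = 1)
    {A : Finset (Dual ℝ N)} {τ : Set X} :
    τ ∈ P.affinityLoci (fun x => bend A (ι x)) ↔
      ∃ σ ∈ P.cells, τ ⊆ σ ∧ IsLocus A (ι '' σ) (ι '' τ) := by
  refine exists_congr fun σ => and_congr_right fun hσ => and_congr_right fun hτ => ?_
  have hinj := (hP σ hσ).2
  constructor
  · rintro ⟨l, hl, h⟩
    rw [hP.M_eq hu hσ] at hl
    obtain ⟨a, ha⟩ := mem_pullback.1 hl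
    refine ⟨a, ?_, Subset.antisymm ?_ ?_⟩
    · rintro _ ⟨x, hx, rfl⟩
      rw [← ha ⟨x, hx⟩]
      by_cases hxτ : x ∈ τ
      · exact ((h ⟨x, hx⟩).1 hxτ).le
      · exact ((h ⟨x, hx⟩).2 hxτ).le
    · rintro _ ⟨x, hx, rfl⟩
      exact ⟨mem_image_of_mem ι (hτ hx), ((h ⟨x, hτ hx⟩).1 hx).trans (ha _)⟩
    · rintro _ ⟨⟨x, hx, rfl⟩, h'⟩
      refine mem_image_of_mem ι ?_
      by_contra hxτ
      have := (h ⟨x, hx⟩).2 hxτ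
      rw [ha] at this
      exact this.ne h'
  · rintro ⟨a, hle, heq⟩
    refine ⟨fun x => a (ι x), ?_, fun x => ⟨fun hx => ?_, fun hx => ?_⟩⟩
    · rw [hP.M_eq hu hσ]
      exact mem_pullback.2 ⟨a, fun _ => rfl⟩
    · exact (heq.subset (mem_image_of_mem ι hx)).2
    · refine lt_of_le_of_ne (hle _ (mem_image_of_mem ι x.2)) fun h => hx ?_
      have : ι x ∈ ι '' τ := heq ▸ ⟨mem_image_of_mem ι x.2, h⟩
      obtain ⟨y, hy, hyx⟩ := this
      rwa [← hinj (hτ hy) x.2 hyx]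

omit [FiniteDimensional ℝ N] in
theorem Adapted.inter_preimage_mem_affinityLoci (hP : P.Adapted ι) (hu : ∀ x, u (ι x) = 1)
    {A : Finset (Dual ℝ N)} {σ : Set X} (hσ : σ ∈ P.cells) {D : Set N}
    (hD : IsLocus A (ι '' σ) D) :
    σ ∩ ι ⁻¹' D ∈ P.affinityLoci (fun x => bend A (ι x)) := by
  refine (hP.mem_affinityLoci_iff hu).2 ⟨σ, hσ, inter_subset_left, ?_⟩
  rw [image_inter_preimage, inter_eq_right.2]
  · exact hD
  · obtain ⟨l, _, rfl⟩ := hD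
    exact fun v hv => hv.1

theorem Adapted.finite_affinityLoci (hP : P.Adapted ι) (hu : ∀ x, u (ι x) = 1)
    (A : Finset (Dual ℝ N)) {T : Set (Set X)} (hT : T.Finite) (hTP : T ⊆ P.cells) :
    {τ | ∃ σ ∈ T, τ ⊆ σ ∧ IsLocus A (ι '' σ) (ι '' τ)}.Finite := by
  have : ∀ σ ∈ T, {τ | τ ⊆ σ ∧ IsLocus A (ι '' σ) (ι '' τ)}.Finite := by
    intro σ hσ
    refine ((hP.isPolyhedron hu (hTP hσ)).finite_loci (A := A)).image
      (fun D => σ ∩ ι ⁻¹' D) |>.subset ?_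
    rintro τ ⟨hτ, h⟩
    refine ⟨_, h, Subset.antisymm ?_ fun x hx => ⟨hτ hx, mem_image_of_mem ι hx⟩⟩
    rintro x ⟨hx, y, hy, hyx⟩
    rwa [← (hP σ (hTP hσ)).2 (hτ hy) hx hyx]
  refine (hT.biUnion this).subset ?_
  rintro τ ⟨σ, hσ, h⟩
  exact mem_biUnion hσ h

theorem isClosed_of_isLocus {σ τ : Set X} (hσ : IsClosed σ)
    (hι : IsEmbedding (fun x : σ => ι x)) {A : Finset (Dual ℝ N)} (hτ : τ ⊆ σ)
    (h : IsLocus A (ι '' σ) (ι '' τ)) : IsClosed τ := by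
  obtain ⟨l, _, h⟩ := h
  have hc : IsClosed {x : σ | bend A (ι x) = l (ι x)} :=
    isClosed_eq ((continuous_bend A).comp hι.continuous)
      (l.continuous_of_finiteDimensional.comp hι.continuous)
  convert hσ.isClosedEmbedding_subtypeVal.isClosedMap _ hc
  ext x
  constructor
  · intro hx
    exact ⟨⟨x, hτ hx⟩, (h.subset (mem_image_of_mem ι hx)).2, rfl⟩
  · rintro ⟨x, hx, rfl⟩
    have : ι x ∈ ι '' τ := h ▸ ⟨mem_image_of_mem ι x.2, hx⟩
    obtain ⟨y, hy, hyx⟩ := this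
    have := hι.injective (a₁ := ⟨y, hτ hy⟩) (a₂ := x) hyx
    rwa [← this]

/-- The part of `τ₁` in `σ₂` is a face of `τ₁`, because `σ₁` and `σ₂` meet in a face. On it `bend A`
equals `l₁` and is at most `l₂`, so `l₂ - l₁` is nonnegative and vanishes precisely on `τ₁ ∩ τ₂`. -/
theorem Adapted.isFaceOf_inter (hP : P.Adapted ι) (hu : ∀ x, u (ι x) = 1)
    {A : Finset (Dual ℝ N)} {σ₁ σ₂ τ₁ τ₂ : Set X} (hσ₁ : σ₁ ∈ P.cells) (hσ₂ : σ₂ ∈ P.cells)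
    (hτ₁ : τ₁ ⊆ σ₁) (hτ₂ : τ₂ ⊆ σ₂) (h₁ : IsLocus A (ι '' σ₁) (ι '' τ₁))
    (h₂ : IsLocus A (ι '' σ₂) (ι '' τ₂)) : IsFaceOf (ι '' τ₁) (ι '' (τ₁ ∩ τ₂)) := by
  have hinj₁ := (hP σ₁ hσ₁).2
  have hinj₂ := (hP σ₂ hσ₂).2
  have hface := ((hP.isCellFace_iff hu hσ₁).1 (P.inter_face σ₁ hσ₁ σ₂ hσ₂).1).2
  have hc := (h₁.isPolyhedron (hP.isPolyhedron hu hσ₁)).convex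
  have hface' := hface.inter_of_subset (image_mono hτ₁) hc
  obtain ⟨l₁, hl₁, e₁⟩ := h₁
  obtain ⟨l₂, hl₂, e₂⟩ := h₂
  have hbend : ∀ x ∈ τ₁, bend A (ι x) = l₁ (ι x) := fun x hx =>
    (e₁.subset (mem_image_of_mem ι hx)).2
  have hmem : ∀ v ∈ ι '' τ₁ ∩ ι '' (σ₁ ∩ σ₂), ∃ x ∈ τ₁, x ∈ σ₂ ∧ ι x = v := by
    rintro _ ⟨⟨x, hx, rfl⟩, y, hy, hyx⟩
    rw [hinj₁ hy.1 (hτ₁ hx) hyx] at hy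
    exact ⟨x, hx, hy.2, rfl⟩
  refine hface'.trans ?_
  convert isFaceOf_zeros hface'.1 (l₂ - l₁).toAffineMap ?_ using 1
  · ext v
    constructor
    · rintro ⟨x, ⟨hx₁, hx₂⟩, rfl⟩
      refine ⟨⟨mem_image_of_mem ι hx₁, mem_image_of_mem ι ⟨hτ₁ hx₁, hτ₂ hx₂⟩⟩, ?_⟩
      have := (e₂.subset (mem_image_of_mem ι hx₂)).2
      have := hbend x hx₁
      simp only [LinearMap.coe_toAffineMap, LinearMap.sub_apply]
      linarith
    · rintro ⟨hv, hv0⟩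
      obtain ⟨x, hx₁, hxσ, rfl⟩ := hmem v hv
      simp only [LinearMap.coe_toAffineMap, LinearMap.sub_apply] at hv0
      have : ι x ∈ ι '' τ₂ := e₂ ▸ ⟨mem_image_of_mem ι hxσ, by linarith [hbend x hx₁]⟩
      obtain ⟨y, hy, hyx⟩ := this
      rw [hinj₂ (hτ₂ hy) hxσ hyx] at hy
      exact mem_image_of_mem ι ⟨hx₁, hy⟩
  · intro v hv
    obtain ⟨x, hx₁, hxσ, rfl⟩ := hmem v hv
    have := hl₂ _ (mem_image_of_mem ι hxσ)
    simp only [LinearMap.coe_toAffineMap, LinearMap.sub_apply]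
    linarith [hbend x hx₁]

/-- The affinity loci of the pullback of `bend A` form a polyhedral structure. -/
theorem Adapted.exists_bending (hP : P.Adapted ι) (hu : ∀ x, u (ι x) = 1)
    (A : Finset (Dual ℝ N)) :
    ∃ P' : PolyhedralStructure X, P'.cells = P.affinityLoci (fun x => bend A (ι x)) ∧
      P'.M = pullback ι := by
  have hmem := fun τ => hP.mem_affinityLoci_iff hu (A := A) (τ := τ)
  refine ⟨ofFamily ι u hu (P.affinityLoci fun x => bend A (ι x)) ?_ ?_ ?_ ?_ ?_ ?_ ?_, rfl, rfl⟩
  · intro τ hτ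
    obtain ⟨σ, hσ, hτσ, h⟩ := (hmem τ).1 hτ
    exact isClosed_of_isLocus (P.isClosed σ hσ) (hP.isEmbedding hu hσ) hτσ h
  · refine eq_univ_of_forall fun x => ?_
    obtain ⟨σ, hσ, hx⟩ := P.covers.symm.subset (mem_univ x)
    obtain ⟨s, _, hs⟩ := exists_chamberFn_eq A (ι x)
    exact ⟨_, hP.inter_preimage_mem_affinityLoci hu hσ (isLocus_chamberFn s), hx,
      mem_image_of_mem ι hx, hs⟩
  · intro x
    obtain ⟨t, ht, hfin⟩ := P.locallyFinite x
    refine ⟨t, ht, ?_⟩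
    have h1 := hP.finite_affinityLoci hu A (hfin.image Subtype.val)
      (by rintro _ ⟨σ, _, rfl⟩; exact σ.2)
    refine (h1.preimage Subtype.val_injective.injOn).subset ?_
    rintro ⟨τ, hτ⟩ ⟨y, hy, hyt⟩
    obtain ⟨σ, hσ, hτσ, h⟩ := (hmem τ).1 hτ
    exact ⟨σ, ⟨⟨σ, hσ⟩, ⟨y, hτσ hy, hyt⟩, rfl⟩, hτσ, h⟩
  · intro τ hτ
    obtain ⟨σ, hσ, hτσ, h⟩ := (hmem τ).1 hτ
    exact (hP.isEmbedding hu hσ).comp (IsEmbedding.inclusion hτσ)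
  · intro τ hτ
    obtain ⟨σ, hσ, hτσ, h⟩ := (hmem τ).1 hτ
    exact h.isPolyhedron (hP.isPolyhedron hu hσ)
  · intro τ hτ ρ hρ hface
    obtain ⟨σ, hσ, hτσ, h⟩ := (hmem τ).1 hτ
    refine (hmem ρ).2 ⟨σ, hσ, hρ.trans hτσ, h.of_isFaceOf (u := u) ?_ (hP.isPolyhedron hu hσ) hface⟩
    rintro _ ⟨x, _, rfl⟩
    exact hu x
  · intro τ₁ hτ₁ τ₂ hτ₂
    obtain ⟨σ₁, hσ₁, hτσ₁, h₁⟩ := (hmem τ₁).1 hτ₁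
    obtain ⟨σ₂, hσ₂, hτσ₂, h₂⟩ := (hmem τ₂).1 hτ₂
    exact hP.isFaceOf_inter hu hσ₁ hσ₂ hτσ₁ hτσ₂ h₁ h₂

variable {A : Finset (Dual ℝ N)} {P' Q Q' : PolyhedralStructure X}

omit [FiniteDimensional ℝ N] in
theorem Adapted.bending_isSubdivision (hP : P.Adapted ι) (hu : ∀ x, u (ι x) = 1)
    (hcells : P'.cells = P.affinityLoci (fun x => bend A (ι x))) (hM : P'.M = pullback ι) :
    P'.IsSubdivision P := by
  intro τ hτ
  rw [hcells] at hτ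
  obtain ⟨σ, hσ, hτσ, -⟩ := hτ
  refine ⟨σ, hσ, hτσ, isAffineOn_ev_inclusion hτσ fun m hm => ?_⟩
  rw [hP.M_eq hu hσ] at hm
  rw [hM]
  exact comp_inclusion_mem_pullback hτσ hm

/-- Bending along the same hyperplanes is compatible with subdivision. -/
theorem Adapted.bending_mono (hP : P.Adapted ι) (hu : ∀ x, u (ι x) = 1)
    (hcells : P'.cells = P.affinityLoci (fun x => bend A (ι x))) (hM : P'.M = pullback ι)
    (hQ : Q.IsSubdivision P) (hcells' : Q'.cells = Q.affinityLoci (fun x => bend A (ι x)))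
    (hM' : Q'.M = pullback ι) : Q'.IsSubdivision P' := by
  intro τ hτ
  have hQa := hP.of_isSubdivision hQ
  rw [hcells', hQa.mem_affinityLoci_iff hu] at hτ
  obtain ⟨σ, hσ, hτσ, h⟩ := hτ
  obtain ⟨σ', hσ', hσσ', -⟩ := hQ σ hσ
  -- A sign pattern `s` makes sense on every cell: the chamber of the larger cell `σ'` with the same
  -- signs contains `τ`.
  obtain ⟨s, -, hs⟩ := h.exists_chamber (hQa.isPolyhedron hu hσ)
  have hsub : τ ⊆ σ' ∩ ι ⁻¹' touching A (ι '' σ') (chamberFn A s) := fun x hx =>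
    ⟨hσσ' (hτσ hx), mem_image_of_mem ι (hσσ' (hτσ hx)),
      (hs.2.subset (mem_image_of_mem ι hx)).2⟩
  refine ⟨_, hcells ▸ hP.inter_preimage_mem_affinityLoci hu hσ' (isLocus_chamberFn s), hsub,
    isAffineOn_ev_inclusion hsub fun m hm => ?_⟩
  rw [hM] at hm
  rw [hM']
  exact comp_inclusion_mem_pullback hsub hm

/-- A common subdivision of `P₀` and `P`, bent along the same `A`, is a common subdivision of `P₀`
and `P'`. -/
theorem Adapted.bending_equivalent {P₀ : PolyhedralStructure X} (hP : P.Adapted ι)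
    (hu : ∀ x, u (ι x) = 1)
    (hcells : P'.cells = P.affinityLoci (fun x => bend A (ι x))) (hM : P'.M = pullback ι)
    (h : P₀.Equivalent P) : P₀.Equivalent P' := by
  obtain ⟨Q, hQ₀, hQ⟩ := h
  have hQa := hP.of_isSubdivision hQ
  obtain ⟨Q', hcells', hM'⟩ := hQa.exists_bending hu A
  exact ⟨Q', (hQa.bending_isSubdivision hu hcells' hM').trans hQ₀,
    hP.bending_mono hu hcells hM hQ hcells' hM'⟩

end PolyhedralStructure

end BendingSubdivision

theorem finrank_vectorSpan_add_one {W : Type*} [AddCommGroup W] [Module ℝ W]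
    [FiniteDimensional ℝ W] {S : Set W} {u : Dual ℝ W} (hS : ∀ x ∈ S, u x = 1)
    (hne : S.Nonempty) :
    finrank ℝ (vectorSpan ℝ S) + 1 = finrank ℝ (Submodule.span ℝ S) := by
  obtain ⟨p, hp⟩ := hne
  have h0 : u.domRestrict (Submodule.span ℝ S) ≠ 0 := fun h => by
    have := LinearMap.congr_fun h ⟨p, Submodule.subset_span hp⟩
    simp [hS p hp] at this
  rw [← Module.Dual.finrank_ker_add_one_of_ne_zero h0, vectorSpan_eq_span_inf_ker hS,
    ← Submodule.map_comap_subtype, ← LinearMap.ker_domRestrict, Submodule.finrank_map_subtype_eq]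

/-! ### Inner normals to facets, and the slopes of the bending function along them. -/

section Normal

variable {N : Type*} [NormedAddCommGroup N] [InnerProductSpace ℝ N]

/-- `v` is a unit vector in the span of `D`, normal to the subset `F`, pointing towards `D`. -/
structure IsInnerNormal (F D : Set N) (v : N) : Prop where
  norm_eq : ‖v‖ = 1
  mem : v ∈ vectorSpan ℝ D
  orth : ∀ w ∈ vectorSpan ℝ F, inner ℝ w v = 0
  nonneg : ∀ p ∈ F, ∀ q ∈ D, 0 ≤ inner ℝ (q - p) v

/-- By dimension, the orthogonal complement of `T` in `S` is the line through `v`. Once the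
`v`-component of `y` is removed, what remains differs from its projection to `T` by a multiple of
`v` that is orthogonal to `v`, hence zero. -/
theorem sub_inner_smul_mem {T S : Submodule ℝ N} [FiniteDimensional ℝ N] (hTS : T ≤ S)
    (hrank : finrank ℝ S = finrank ℝ T + 1) {v : N} (hv : ‖v‖ = 1) (hvS : v ∈ S)
    (hvT : ∀ w ∈ T, inner ℝ w v = 0) {y : N} (hy : y ∈ S) : y - (inner ℝ y v : ℝ) • v ∈ T := by
  have h1 : finrank ℝ (Tᗮ ⊓ S : Submodule ℝ N) = 1 := by
    have := Submodule.finrank_add_inf_finrank_orthogonal hTS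
    omega
  have hvv : inner ℝ v v = (1 : ℝ) := by rw [real_inner_self_eq_norm_sq, hv]; norm_num
  have hv' : v ∈ Tᗮ ⊓ S := ⟨(Submodule.mem_orthogonal T v).2 hvT, hvS⟩
  have hv0 : (⟨v, hv'⟩ : (Tᗮ ⊓ S : Submodule ℝ N)) ≠ 0 := fun h => by
    have : v = 0 := congrArg Subtype.val h
    simp [this] at hv
  set z := y - (inner ℝ y v : ℝ) • v with hz
  have hzS : z ∈ S := sub_mem hy (S.smul_mem _ hvS)
  have hzv : inner ℝ z v = (0 : ℝ) := by
    rw [hz, inner_sub_left, real_inner_smul_left, hvv]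
    ring
  set t := T.starProjection z with ht
  have htT : t ∈ T := Submodule.starProjection_apply_mem T z
  have hr : z - t ∈ Tᗮ ⊓ S :=
    ⟨Submodule.sub_starProjection_mem_orthogonal z, sub_mem hzS (hTS htT)⟩
  obtain ⟨c, hc⟩ := (finrank_eq_one_iff_of_nonzero' _ hv0).1 h1 ⟨z - t, hr⟩
  have hc' : c • v = z - t := congrArg Subtype.val hc
  have hc0 : c = 0 := by
    have h2 : inner ℝ (c • v) v = (0 : ℝ) := by
      rw [hc', inner_sub_left, hzv, hvT t htT, sub_zero]
    rwa [real_inner_smul_left, hvv, mul_one] at h2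
  rw [hc0, zero_smul] at hc'
  rw [← sub_eq_zero.1 hc'.symm] at htT
  exact htT

/-- The directions of `D` orthogonal to `F` form a line; take a unit vector on it. Its inner product
with `q - p₀` cannot take both signs for `q` in `D`: between points of opposite sign there is a
zero, zeros lie in `F`, and extremality would pull the end points into `F`. It remains to choose the
sign of the vector. -/
theorem IsFaceOf.exists_isInnerNormal [FiniteDimensional ℝ N] {F D : Set N} (h : IsFaceOf D F)
    (hne : F.Nonempty) (hD : Convex ℝ D)
    (hrank : finrank ℝ (vectorSpan ℝ D) = finrank ℝ (vectorSpan ℝ F) + 1) :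
    ∃ v, IsInnerNormal F D v := by
  obtain ⟨p₀, hp₀⟩ := hne
  have hTS : vectorSpan ℝ F ≤ vectorSpan ℝ D := vectorSpan_mono ℝ h.2.subset
  have h1 : finrank ℝ ((vectorSpan ℝ F)ᗮ ⊓ vectorSpan ℝ D : Submodule ℝ N) = 1 := by
    have := Submodule.finrank_add_inf_finrank_orthogonal hTS
    omega
  obtain ⟨⟨w, hwT, hwS⟩, hw0⟩ : ∃ w : ((vectorSpan ℝ F)ᗮ ⊓ vectorSpan ℝ D : Submodule ℝ N), w ≠ 0 :=
    @exists_ne _ (nontrivial_of_finrank_pos (R := ℝ) (by omega)) 0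
  have hw0' : w ≠ 0 := fun h => hw0 (Subtype.ext h)
  set v := ‖w‖⁻¹ • w with hv
  have hv1 : ‖v‖ = 1 := by
    rw [hv, norm_smul, norm_inv, norm_norm, inv_mul_cancel₀ (norm_ne_zero_iff.2 hw0')]
  have hvS : v ∈ vectorSpan ℝ D := Submodule.smul_mem _ _ hwS
  have hvT : ∀ x ∈ vectorSpan ℝ F, inner ℝ x v = (0 : ℝ) :=
    (Submodule.mem_orthogonal _ _).1 (Submodule.smul_mem _ _ hwT)
  -- The values on `D` do not depend on the point of `F`, and do not change sign.
  have hF : ∀ p ∈ F, ∀ q : N, inner ℝ (q - p) v = (inner ℝ (q - p₀) v : ℝ) := by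
    intro p hp q
    have := hvT (p₀ - p) (vsub_mem_vectorSpan ℝ hp₀ hp)
    rw [← sub_add_sub_cancel q p₀ p, inner_add_left, this, add_zero]
  have hmem : ∀ q ∈ D, inner ℝ (q - p₀) v = (0 : ℝ) → q ∈ F := by
    intro q hq h0
    have hqS : q - p₀ ∈ vectorSpan ℝ D := vsub_mem_vectorSpan ℝ hq (h.2.subset hp₀)
    have := sub_inner_smul_mem hTS hrank hv1 hvS hvT hqS
    rw [h0, zero_smul, sub_zero] at this
    exact h.mem_of_sub_mem_vectorSpan hp₀ hq this
  have hsign : ∀ q ∈ D, ∀ q' ∈ D, 0 < inner ℝ (q - p₀) v → ¬ inner ℝ (q' - p₀) v < (0 : ℝ) := by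
    intro q hq q' hq' hpos hneg
    set r := (inner ℝ (q - p₀) v : ℝ) with hr
    set r' := (inner ℝ (q' - p₀) v : ℝ) with hr'
    have hd : 0 < r - r' := by linarith
    have ha : 0 < -r' / (r - r') := div_pos (by linarith) hd
    have hb : 0 < r / (r - r') := div_pos hpos hd
    have hab : -r' / (r - r') + r / (r - r') = 1 := by field_simp; ring
    have hz : (-r' / (r - r')) • q + (r / (r - r')) • q' ∈ F := by
      refine hmem _ (hD hq hq' ha.le hb.le hab) ?_
      have : (-r' / (r - r')) • q + (r / (r - r')) • q' - p₀ =
          (-r' / (r - r')) • (q - p₀) + (r / (r - r')) • (q' - p₀) := by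
        calc _ = (-r' / (r - r')) • q + (r / (r - r')) • q' -
              (-r' / (r - r') + r / (r - r')) • p₀ := by rw [hab, one_smul]
          _ = _ := by module
      rw [this, inner_add_left, real_inner_smul_left, real_inner_smul_left, ← hr, ← hr']
      ring
    have hq := h.2.left_mem_of_mem_openSegment hq hq' hz ⟨_, _, ha, hb, hab, rfl⟩
    have := hvT (q - p₀) (vsub_mem_vectorSpan ℝ hq hp₀)
    exact hpos.ne' this
  by_cases hpos : ∃ q ∈ D, 0 < (inner ℝ (q - p₀) v : ℝ)
  · obtain ⟨q, hq, hpos⟩ := hpos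
    refine ⟨v, hv1, hvS, hvT, fun p hp q' hq' => ?_⟩
    rw [hF p hp]
    exact not_lt.1 (hsign q hq q' hq' hpos)
  · push Not at hpos
    refine ⟨-v, by rwa [norm_neg], neg_mem hvS, fun x hx => ?_, fun p hp q hq => ?_⟩
    · rw [inner_neg_right, hvT x hx, neg_zero]
    · rw [inner_neg_right, hF p hp]
      exact neg_nonneg.2 (hpos q hq)

/-- Otherwise `v` would be orthogonal to all directions of `D`, in particular to itself. -/
theorem IsInnerNormal.exists_pos {F D : Set N} {v : N} (hv : IsInnerNormal F D v) {p : N}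
    (hp : p ∈ F) (hpD : p ∈ D) : ∃ q ∈ D, 0 < (inner ℝ (q - p) v : ℝ) := by
  by_contra! h
  have h0 : ∀ q ∈ D, inner ℝ (q - p) v = (0 : ℝ) := fun q hq =>
    le_antisymm (h q hq) (hv.nonneg p hp q hq)
  have h1 : vectorSpan ℝ D ≤ LinearMap.ker (innerₗ N v) := by
    rw [vectorSpan_eq_span_vsub_set_right ℝ hpD, Submodule.span_le]
    rintro _ ⟨q, hq, rfl⟩
    rw [SetLike.mem_coe, LinearMap.mem_ker, innerₗ_apply_apply, real_inner_comm]
    exact h0 q hq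
  have h2 := h1 hv.mem
  rw [LinearMap.mem_ker, innerₗ_apply_apply, real_inner_self_eq_norm_sq, hv.norm_eq] at h2
  norm_num at h2

theorem sgn_eq_one_or (s : Finset (Dual ℝ N)) (a : Dual ℝ N) : sgn s a = 1 ∨ sgn s a = -1 := by
  unfold sgn
  split_ifs <;> simp

/-- A linear function is determined on the span of a set by its values on the set. -/
theorem eqOn_span_of_eqOn {l l' : Dual ℝ N} {D : Set N} (h : ∀ x ∈ D, l x = l' x) {v : N}
    (hv : v ∈ Submodule.span ℝ D) : l v = l' v :=
  LinearMap.eqOn_span h hv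

/-- Near `F`, the function `bend A` differs from a linear function by the functions `|a|`, where `a`
vanishes on `F`. -/
theorem exists_sub_eq_sum_abs [FiniteDimensional ℝ N] (A : Finset (Dual ℝ N)) {F : Set N}
    (hF : Convex ℝ F) (hne : F.Nonempty) {l₀ : Dual ℝ N} (hl₀ : ∀ x ∈ F, bend A x = l₀ x) :
    ∃ m : Dual ℝ N, ∀ (D : Set N) (v : N) (l : Dual ℝ N), IsFaceOf D F → Convex ℝ D →
      finrank ℝ (vectorSpan ℝ D) = finrank ℝ (vectorSpan ℝ F) + 1 → IsInnerNormal F D v →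
      (∀ x ∈ D, bend A x = l x) →
      0 ≤ m v - l v ∧ (m v - l v = 0 → ∀ a ∈ A, (∀ x ∈ F, a x = 0) → a v = 0) := by
  classical
  obtain ⟨s₀, -, hs₀⟩ := exists_chamberFn_eqOn A hF hl₀
  simp only [bend_eq_chamberFn_iff] at hs₀
  -- Only functions not vanishing identically on `F` are kept; their signs are already fixed on `F`,
  -- so this choice is independent of `D`.
  refine ⟨-∑ a ∈ A, if ∀ x ∈ F, a x = 0 then 0 else sgn s₀ a • a,
    fun D v l hface hD hrank hv hl => ?_⟩
  obtain ⟨s, -, hs⟩ := exists_chamberFn_eqOn A hD hl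
  have hls : l v = chamberFn A s v :=
    eqOn_span_of_eqOn (fun x hx => (hl x hx).symm.trans (hs x hx)) (vectorSpan_le_span D hv.mem)
  simp only [bend_eq_chamberFn_iff] at hs
  obtain ⟨p, hp⟩ := hne
  have hpD := hface.2.subset hp
  obtain ⟨q, hq, hr⟩ := hv.exists_pos hp hpD
  -- Up to a direction of `F`, `q - p` is the positive multiple `r • v`. Thus a function vanishing
  -- on `F` has the same sign at `v` as at `q`.
  have hdec := sub_inner_smul_mem (vectorSpan_mono ℝ hface.2.subset) hrank hv.norm_eq hv.mem
    hv.orth (vsub_mem_vectorSpan ℝ hq hpD)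
  rw [vsub_eq_sub] at hdec
  set r := (inner ℝ (q - p) v : ℝ) with hrdef
  have hvan : ∀ a ∈ A, (∀ x ∈ F, a x = 0) → sgn s a * a v = |a v| := by
    intro a ha h0
    have hz : a (q - p - r • v) = 0 :=
      eqOn_span_of_eqOn (l' := 0) h0 (vectorSpan_le_span F hdec)
    have hq' : a q = r * a v := by
      rw [map_sub, map_sub, h0 p hp, map_smul, smul_eq_mul] at hz
      linarith
    have := hs q hq a ha
    rw [hq', abs_mul, abs_of_pos hr] at this
    exact mul_left_cancel₀ hr.ne' (by linarith)
  have hnon : ∀ a ∈ A, (¬ ∀ x ∈ F, a x = 0) → sgn s a = sgn s₀ a := by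
    intro a ha h0
    push Not at h0
    obtain ⟨x, hx, hax⟩ := h0
    exact mul_right_cancel₀ hax
      ((hs x (hface.2.subset hx) a ha).trans (hs₀ x hx a ha).symm)
  have key : (-∑ a ∈ A, if ∀ x ∈ F, a x = 0 then 0 else sgn s₀ a • a : Dual ℝ N) v - l v =
      ∑ a ∈ A, if ∀ x ∈ F, a x = 0 then |a v| else 0 := by
    rw [hls, chamberFn_apply, LinearMap.neg_apply, LinearMap.sum_apply, neg_sub_neg,
      ← Finset.sum_sub_distrib]
    refine Finset.sum_congr rfl fun a ha => ?_
    split_ifs with h0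
    · rw [hvan a ha h0]
      simp
    · rw [hnon a ha h0]
      simp
  have hterm : ∀ a ∈ A, 0 ≤ if ∀ x ∈ F, a x = 0 then |a v| else 0 := by
    intro a _
    split_ifs
    exacts [abs_nonneg _, le_rfl]
  rw [key]
  refine ⟨Finset.sum_nonneg hterm, fun h a ha h0 => ?_⟩
  have := (Finset.sum_eq_zero_iff_of_nonneg hterm).1 h a ha
  rw [if_pos h0] at this
  exact abs_eq_zero.1 this

/-- Let `F` be a subset of the affinity locus of `bend A` in a polyhedron which is defined by
functions in `A`. An inner normal vector is not killed by all functions in `A` vanishing on `F`. -/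
theorem IsInnerNormal.exists_ne_zero {A s : Finset (Dual ℝ N)} (hsA : s ⊆ A) {u l : Dual ℝ N}
    {F C : Set N} (hC : C = {x | u x = 1 ∧ ∀ b ∈ s, 0 ≤ b x}) (hD : Convex ℝ (touching A C l))
    (hF : Convex ℝ F) (hne : F.Nonempty) (hFD : F ⊆ touching A C l) {v : N}
    (hv : IsInnerNormal F (touching A C l) v) : ∃ a ∈ A, (∀ x ∈ F, a x = 0) ∧ a v ≠ 0 := by
  classical
  by_contra! hall
  obtain ⟨s₀, -, hs₀⟩ := exists_chamberFn_eqOn A hD fun x hx => hx.2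
  have hu : ∀ x ∈ touching A C l, u x = 1 := fun x hx => (hC.subset hx.1).1
  have hls : ∀ y ∈ Submodule.span ℝ (touching A C l), l y = chamberFn A s₀ y := fun y hy =>
    eqOn_span_of_eqOn (fun x hx => hx.2.symm.trans (hs₀ x hx)) hy
  have huv : u v = 0 := by
    have := hv.mem
    rw [vectorSpan_eq_span_inf_ker hu] at this
    exact this.2
  simp only [bend_eq_chamberFn_iff] at hs₀
  -- With the signs of `s₀`, all functions in `A` are nonnegative on `F`. One that vanishes at the
  -- generic `p` therefore vanishes on `F`, and so kills `v` by assumption.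
  obtain ⟨p, hp, hgen⟩ := exists_generic_point A (fun a => (sgn s₀ a • a).toAffineMap) hF hne
  simp only [LinearMap.coe_toAffineMap, LinearMap.smul_apply, smul_eq_mul] at hgen
  have hpD := hFD hp
  have hkill : ∀ a ∈ A, a p = 0 → a v = 0 := by
    intro a ha h0
    refine hall a ha fun x hx => ?_
    have h1 := hgen a ha (fun y hy => (hs₀ y (hFD hy) a ha).symm ▸ abs_nonneg _) (by rw [h0, mul_zero])
      x hx
    rw [hs₀ x (hFD hx) a ha] at h1
    exact abs_eq_zero.1 h1
  obtain ⟨δ, hδ, hstep⟩ := exists_small_step A (fun a => |a p|) (fun a => sgn s₀ a * a v)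
    fun a ha => by
      by_cases h0 : a p = 0
      · exact Or.inr ⟨abs_nonneg _, by rw [hkill a ha h0, mul_zero]⟩
      · exact Or.inl (abs_pos.2 h0)
  have hpos : ∀ a ∈ A, 0 ≤ sgn s₀ a * a (p - δ • v) := by
    intro a ha
    have := hstep a ha
    rw [← hs₀ p hpD a ha] at this
    rw [map_sub, map_smul, smul_eq_mul]
    linarith
  -- The short step keeps the signs `s₀`. An inequality of `C` either is tight at `p` and kills `v`,
  -- or is strict at `p`, which makes its sign in `s₀` positive.
  have hmem : p - δ • v ∈ touching A C l := by
    refine ⟨?_, ?_⟩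
    · rw [hC]
      refine ⟨by rw [map_sub, map_smul, huv, smul_zero, sub_zero, hu p hpD], fun b hb => ?_⟩
      have hbp := (hC.subset hpD.1).2 b hb
      rcases hbp.eq_or_lt with h0 | h0
      · rw [map_sub, map_smul, ← h0, hkill b (hsA hb) h0.symm, smul_zero, sub_zero]
      · have h1 := hs₀ p hpD b (hsA hb)
        rw [abs_of_pos h0] at h1
        have h2 := hpos b (hsA hb)
        rwa [mul_right_cancel₀ h0.ne' (h1.trans (one_mul _).symm), one_mul] at h2
    · rw [hls _ (sub_mem (Submodule.subset_span hpD)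
        (Submodule.smul_mem _ _ (vectorSpan_le_span _ hv.mem))), bend_eq_chamberFn_iff]
      intro a ha
      rcases sgn_eq_one_or s₀ a with h | h
      · have := hpos a ha
        rw [h, one_mul] at this ⊢
        rw [abs_of_nonneg this]
      · have := hpos a ha
        rw [h] at this ⊢
        rw [abs_of_nonpos (by linarith)]
        ring
  have := hv.nonneg p hp _ hmem
  rw [sub_sub_cancel_left, inner_neg_left, real_inner_smul_left, real_inner_self_eq_norm_sq,
    hv.norm_eq] at this
  linarith

end Normal

/-! ### Strict and strong concavity of the pulled back bending function. -/

theorem IsPolyhedron.exists_linear {W : Type*} [AddCommGroup W] [Module ℝ W] {C : Set W}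
    (hC : IsPolyhedron C) {u : Dual ℝ W} (hu : ∀ x ∈ C, u x = 1) :
    ∃ s : Finset (Dual ℝ W), C = {x | u x = 1 ∧ ∀ b ∈ s, 0 ≤ b x} := by
  classical
  obtain ⟨t, rfl⟩ := hC
  choose g hg using exists_linear_eq u
  refine ⟨t.image g, ?_⟩
  ext x
  simp only [mem_ofPred_eq, Finset.forall_mem_image]
  constructor
  · intro hx
    exact ⟨hu x hx, fun a ha => hg a x (hu x hx) ▸ hx a ha⟩
  · rintro ⟨h1, h2⟩ a ha
    rw [hg a x h1]
    exact h2 ha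

theorem PolyhedralStructure.finite_cofaces {X : Type*} [TopologicalSpace X]
    (P : PolyhedralStructure X) (V : Set X) (k : ℕ) {τ : Set X} (hτ : τ.Nonempty) :
    (P.cofaces V k τ).Finite := by
  obtain ⟨x, hx⟩ := hτ
  refine ((P.locallyFinite.point_finite x).image Subtype.val).subset ?_
  rintro σ ⟨⟨⟨hσ, -⟩, -⟩, F, -, rfl⟩
  exact ⟨⟨σ, hσ⟩, show x ∈ σ from Subtype.coe_image_subset σ _ hx, rfl⟩

namespace QuasiEmbeddedPolyhedralSpace

/-- The functional chosen by `linearPart` is determined on the directions of the polyhedron. -/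
theorem linearPart_eq {X : Type*} [TopologicalSpace X] {N : Type*} [NormedAddCommGroup N]
    [NormedSpace ℝ N] (E : QuasiEmbeddedPolyhedralSpace X N) {V σ : Set X} (hV : IsOpen V)
    (hVσ : (σ ∩ V).Nonempty) (hι : IsEmbedding (fun x : σ => E.ι x))
    (hconv : Convex ℝ (E.ι '' σ)) {f : X → ℝ} {l : Dual ℝ N} (hl : ∀ x ∈ σ, f x = l (E.ι x))
    {v : N} (hv : v ∈ vectorSpan ℝ (E.ι '' σ)) : E.linearPart V f σ v = l v := by
  have hex : ∃ g : Dual ℝ N, ∀ x ∈ σ ∩ V, f x = g (E.ι x) := ⟨l, fun x hx => hl x hx.1⟩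
  have hg := hex.choose_spec
  rw [linearPart, dif_pos hex]
  set g := hex.choose
  obtain ⟨x, hxσ, hxV⟩ := hVσ
  have hgl : ∀ y ∈ σ ∩ V, (g - l) (E.ι y) = 0 := fun y hy => by
    rw [LinearMap.sub_apply, ← hg y hy, ← hl y hy.1, sub_self]
  obtain ⟨O, hO, hOV⟩ := hι.isInducing.isOpen_iff.1 (hV.preimage continuous_subtype_val)
  have hVO : ∀ y : σ, E.ι y ∈ O ↔ (y : X) ∈ V := fun y => Set.ext_iff.1 hOV y
  suffices vectorSpan ℝ (E.ι '' σ) ≤ LinearMap.ker (g - l) by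
    have := this hv
    rwa [LinearMap.mem_ker, LinearMap.sub_apply, sub_eq_zero] at this
  rw [vectorSpan_eq_span_vsub_set_right ℝ (mem_image_of_mem E.ι hxσ), Submodule.span_le]
  rintro _ ⟨_, ⟨y, hy, rfl⟩, rfl⟩
  rw [SetLike.mem_coe, LinearMap.mem_ker]
  simp only [vsub_eq_sub]
  -- The start of the segment from `ι x` to `ι y` lies in the image of `σ ∩ V`, where `g` and `l`
  -- agree; so they agree on its direction.
  have hc : Continuous fun t : ℝ => E.ι x + t • (E.ι y - E.ι x) := by fun_prop
  have h0 : ∀ᶠ t : ℝ in 𝓝[>] 0, E.ι x + t • (E.ι y - E.ι x) ∈ O :=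
    (hc.continuousAt.eventually_mem (x := 0) (hO.mem_nhds (by
      simpa using (hVO ⟨x, hxσ⟩).2 hxV))).filter_mono nhdsWithin_le_nhds
  obtain ⟨t, ht, ht0, ht1⟩ := (h0.and (Ioo_mem_nhdsGT one_pos)).exists
  have hmem : E.ι x + t • (E.ι y - E.ι x) ∈ E.ι '' σ := by
    convert hconv (mem_image_of_mem E.ι hxσ) (mem_image_of_mem E.ι hy) (sub_nonneg.2 ht1.le)
      ht0.le (by ring) using 1
    module
  obtain ⟨z, hz, hzt⟩ := hmem
  have h1 := hgl z ⟨hz, (hVO ⟨z, hz⟩).1 (by rw [hzt]; exact ht)⟩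
  rw [hzt, map_add, hgl x ⟨hxσ, hxV⟩, zero_add, map_smul] at h1
  exact (smul_eq_zero.1 h1).resolve_left ht0.ne'

variable {X : Type*} [TopologicalSpace X] {N : Type*} [NormedAddCommGroup N]
  [InnerProductSpace ℝ N] [FiniteDimensional ℝ N] (E : QuasiEmbeddedPolyhedralSpace X N)

/-- Dimensions of function spaces translate into dimensions of direction spaces, so `τ` has
codimension one in `σ`. A normal therefore exists, and `unitNormal` is not its default value. -/
theorem isInnerNormal_unitNormal {P : PolyhedralStructure X} (hP : P.Adapted E.ι) {V τ σ : Set X}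
    {k : ℕ} (hτ : τ ∈ P.restrictDim V k) (hσ : σ ∈ P.cofaces V (k + 1) τ) :
    IsFaceOf (E.ι '' σ) (E.ι '' τ) ∧
      finrank ℝ (vectorSpan ℝ (E.ι '' σ)) = finrank ℝ (vectorSpan ℝ (E.ι '' τ)) + 1 ∧
      IsInnerNormal (E.ι '' τ) (E.ι '' σ) (E.unitNormal τ σ) := by
  obtain ⟨⟨⟨hσc, -⟩, hσk⟩, hface⟩ := hσ
  obtain ⟨⟨hτc, hτV⟩, hτk⟩ := hτ
  have hface := ((hP.isCellFace_iff E.height_ι hσc).1 hface).2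
  have hne : (E.ι '' τ).Nonempty := (hτV.mono inter_subset_left).image _
  have hu : ∀ ρ : Set X, ∀ v ∈ E.ι '' ρ, E.height v = 1 := by
    rintro ρ _ ⟨x, _, rfl⟩
    exact E.height_ι x
  rw [hP.M_eq E.height_ι hσc, finrank_pullback,
    ← finrank_vectorSpan_add_one (hu σ) (hne.mono hface.2.subset)] at hσk
  rw [hP.M_eq E.height_ι hτc, finrank_pullback, ← finrank_vectorSpan_add_one (hu τ) hne] at hτk
  have hrank : finrank ℝ (vectorSpan ℝ (E.ι '' σ)) = finrank ℝ (vectorSpan ℝ (E.ι '' τ)) + 1 := by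
    omega
  refine ⟨hface, hrank, ?_⟩
  obtain ⟨v, hv⟩ := hface.exists_isInnerNormal hne (hP.isPolyhedron E.height_ι hσc).convex hrank
  have hex : ∃ v, E.IsUnitNormal τ σ v := ⟨v, hv.norm_eq, hv.mem, hv.orth, fun x hx y hy =>
    hv.nonneg _ (mem_image_of_mem _ hx) _ (mem_image_of_mem _ hy)⟩
  rw [unitNormal, dif_pos hex]
  obtain ⟨h1, h2, h3, h4⟩ := hex.choose_spec
  refine ⟨h1, h2, h3, ?_⟩
  rintro _ ⟨x, hx, rfl⟩ _ ⟨y, hy, rfl⟩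
  exact h4 x hx y hy

theorem isStrictlyConcave_bend {P P' : PolyhedralStructure X} (hP : P.Adapted E.ι)
    (hP' : P'.Adapted E.ι) {A : Finset (Dual ℝ N)} {U : Set X}
    (hA : ∀ σ ∈ P.restrict U, ∃ s ⊆ A, E.ι '' σ = {x | E.height x = 1 ∧ ∀ b ∈ s, 0 ≤ b x})
    (hcells : P'.cells = P.affinityLoci (fun x => bend A (E.ι x)))
    (hdef : P'.DefinedOn U fun x => bend A (E.ι x)) :
    E.IsStrictlyConcave P' U fun x => bend A (E.ι x) := by
  refine ⟨hdef, fun k τ hτ V hV hVU hVτ c hc hpos => ?_⟩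
  obtain ⟨σ₀, hσ₀, hc₀⟩ := hpos
  have hτV : τ ∈ P'.restrictDim V k := ⟨⟨hτ.1.1, by rwa [inter_comm]⟩, hτ.2⟩
  have hne : τ.Nonempty := hVτ.mono inter_subset_right
  have hloc : ∀ σ ∈ P'.cells, ∃ σ' ∈ P.cells, σ ⊆ σ' ∧ IsLocus A (E.ι '' σ') (E.ι '' σ) := by
    intro σ hσ
    rw [hcells] at hσ
    exact (hP.mem_affinityLoci_iff E.height_ι).1 hσ
  have hlin : ∀ σ ∈ P'.cells, ∃ l : Dual ℝ N, ∀ x ∈ E.ι '' σ, bend A x = l x := by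
    intro σ hσ
    obtain ⟨σ', -, -, l, -, h⟩ := hloc σ hσ
    exact ⟨l, fun x hx => (h.subset hx).2⟩
  have hconv : ∀ σ ∈ P'.cells, Convex ℝ (E.ι '' σ) := fun σ hσ =>
    (hP'.isPolyhedron E.height_ι hσ).convex
  obtain ⟨l₀, hl₀⟩ := hlin τ hτ.1.1
  obtain ⟨m, hm⟩ := exists_sub_eq_sum_abs A (hconv τ hτ.1.1) (hne.image _) hl₀
  have hcof : ∀ σ ∈ P'.cofaces V (k + 1) τ,
      0 ≤ m (E.unitNormal τ σ) - E.linearPart V (fun x => bend A (E.ι x)) σ (E.unitNormal τ σ) ∧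
      (m (E.unitNormal τ σ) - E.linearPart V (fun x => bend A (E.ι x)) σ (E.unitNormal τ σ) = 0 →
        ∀ a ∈ A, (∀ x ∈ E.ι '' τ, a x = 0) → a (E.unitNormal τ σ) = 0) := by
    intro σ hσ
    obtain ⟨hface, hrank, hv⟩ := E.isInnerNormal_unitNormal hP' hτV hσ
    obtain ⟨l, hl⟩ := hlin σ hσ.1.1.1
    rw [E.linearPart_eq hV hσ.1.1.2 (hP'.isEmbedding E.height_ι hσ.1.1.1) (hconv σ hσ.1.1.1)
      (fun x hx => hl _ (mem_image_of_mem _ hx)) hv.mem]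
    exact hm _ _ l hface (hconv σ hσ.1.1.1) hrank hv hl
  have hσ₀pos : 0 < m (E.unitNormal τ σ₀) -
      E.linearPart V (fun x => bend A (E.ι x)) σ₀ (E.unitNormal τ σ₀) := by
    refine lt_of_le_of_ne (hcof σ₀ hσ₀).1 fun h => ?_
    obtain ⟨hface, -, hv⟩ := E.isInnerNormal_unitNormal hP' hτV hσ₀
    obtain ⟨σ', hσ', hσσ', l, -, e⟩ := hloc σ₀ hσ₀.1.1.1
    -- The cell `σ'` containing `σ₀` meets `U` because `σ₀` meets `V ⊆ U`; hence its defining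
    -- functions belong to `A`.
    obtain ⟨s, hsA, hs⟩ := hA σ' ⟨hσ', hσ₀.1.1.2.mono (inter_subset_inter hσσ' hVU)⟩
    have hD := hconv σ₀ hσ₀.1.1.1
    rw [e] at hv hface hD
    obtain ⟨a, ha, ha0, hav⟩ := hv.exists_ne_zero hsA hs hD (hconv τ hτ.1.1) (hne.image _)
      hface.2.subset
    exact hav ((hcof σ₀ hσ₀).2 h.symm a ha ha0)
  have hfin := P'.finite_cofaces V (k + 1) hne
  have hbal := hc.2 τ hτV
  rw [finsum_mem_eq_finite_toFinset_sum _ hfin] at hbal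
  rw [product, finsum_mem_eq_finite_toFinset_sum _ hfin]
  -- Applying `m` to the balancing condition allows `m` to be added to the product for free, leaving
  -- only nonnegative terms.
  have hm0 : ∑ σ ∈ hfin.toFinset, c σ * m (E.unitNormal τ σ) = 0 := by
    have := congrArg m hbal
    simpa [map_sum] using this
  rw [neg_pos, ← hm0, ← sub_pos, ← Finset.sum_sub_distrib]
  simp only [← mul_sub]
  refine Finset.sum_pos' (fun σ hσ => ?_) ⟨σ₀, hfin.mem_toFinset.2 hσ₀, ?_⟩
  · have hσ := hfin.mem_toFinset.1 hσ
    exact mul_nonneg (hc.1 σ hσ.1) (hcof σ hσ).1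
  · exact mul_pos hc₀ hσ₀pos

omit [FiniteDimensional ℝ N] in
theorem isStronglyConcave_bend (A : Finset (Dual ℝ N)) (U : Set X) :
    E.IsStronglyConcave U fun x => bend A (E.ι x) := by
  refine ⟨fun v => bend A v, ?_, fun x _ => rfl⟩
  have h1 : Convex ℝ {p : N × ℝ | E.height p.1 = 1} := by
    rintro p hp q hq a b _ _ hab
    simp only [mem_ofPred_eq] at hp hq ⊢
    simp [hp, hq, hab]
  have h2 := (concaveOn_bend A).convex_hypograph
  convert h1.inter h2 using 1
  ext p
  simp [EReal.coe_le_coe_iff]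

end QuasiEmbeddedPolyhedralSpace

end PolyhedralSpaces

end

/-! ### The main theorem. -/

open PolyhedralSpaces in
theorem theorem3p18 {X : Type*} [TopologicalSpace X] [SecondCountableTopology X]
    {N : Type*} [NormedAddCommGroup N] [InnerProductSpace ℝ N] [FiniteDimensional ℝ N]
    (E : PolyhedralSpaces.QuasiEmbeddedPolyhedralSpace X N)
    (P : PolyhedralSpaces.PolyhedralStructure X) (hP : E.IsComplex P)
    (U : Set X) (hU : IsOpen U) (hfin : (P.restrict U).Finite) :
    ∃ f : X → ℝ, E.IsPiecewiseAffine Set.univ f ∧ E.IsStronglyConcave Set.univ f ∧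
      ∃ P' : PolyhedralSpaces.PolyhedralStructure X,
        P'.cells = P.affinityLoci f ∧ E.IsComplex P' ∧ P'.IsSubdivision P ∧
        (P'.restrict U).Finite ∧ E.IsStrictlyConcave P' U f ∧ E.IsRegular P' U := by
  classical
  obtain ⟨hPE, hPa⟩ := hP
  have hu := E.height_ι
  have hlin : ∀ σ, ∃ s : Finset (Module.Dual ℝ N), σ ∈ P.cells →
      E.ι '' σ = {x | E.height x = 1 ∧ ∀ b ∈ s, 0 ≤ b x} := by
    intro σ
    by_cases hσ : σ ∈ P.cells
    · obtain ⟨s, hs⟩ := (hPa.isPolyhedron hu hσ).exists_linear (u := E.height) (by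
        rintro _ ⟨x, _, rfl⟩
        exact hu x)
      exact ⟨s, fun _ => hs⟩
    · exact ⟨∅, fun h => absurd h hσ⟩
  choose s hs using hlin
  -- Finiteness of `P.restrict U` is what makes this collection of defining functions finite.
  set A := hfin.toFinset.biUnion s
  obtain ⟨P', hcells, hM⟩ := hPa.exists_bending hu A
  have hsub := hPa.bending_isSubdivision hu hcells hM
  have hPa' := hPa.of_isSubdivision hsub
  have hcomplex : E.IsComplex P' := by
    refine ⟨?_, hPa'⟩
    obtain ⟨P₀, h₀⟩ := E.isClass
    rw [h₀] at hPE ⊢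
    exact hPa.bending_equivalent hu hcells hM hPE
  have hdef : ∀ V, P'.DefinedOn V fun x => bend A (E.ι x) := by
    rintro V σ ⟨hσ, -⟩
    rw [hcells, hPa.mem_affinityLoci_iff hu] at hσ
    obtain ⟨σ', -, -, l, -, h⟩ := hσ
    rw [hM]
    exact ⟨fun x => l (E.ι x), mem_pullback.2 ⟨l, fun _ => rfl⟩, fun x _ =>
      (h.subset (Set.mem_image_of_mem _ x.2)).2⟩
  have hconc : E.IsStrictlyConcave P' U fun x => bend A (E.ι x) :=
    E.isStrictlyConcave_bend hPa hPa' (fun σ hσ => ⟨s σ,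
      Finset.subset_biUnion_of_mem s (hfin.mem_toFinset.2 hσ), hs σ hσ.1⟩) hcells (hdef U)
  refine ⟨fun x => bend A (E.ι x), ⟨P', hcomplex, hdef _⟩, E.isStronglyConcave_bend A _,
    P', hcells, hcomplex, hsub, ?_, hconc, _, ⟨P', hcomplex, hdef _⟩, hconc⟩
  refine (hPa.finite_affinityLoci hu A hfin fun σ hσ => hσ.1).subset ?_
  rintro τ ⟨hτ, hτU⟩
  rw [hcells, hPa.mem_affinityLoci_iff hu] at hτ
  obtain ⟨σ, hσ, hτσ, h⟩ := hτ
  exact ⟨σ, ⟨hσ, hτU.mono (Set.inter_subset_inter_left _ hτσ)⟩, hτσ, h⟩
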